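/- Let $v>1$ and let $S$ be a set (repetitions allowed) of $n\ge 1$ points in the plane. For a facility $f\in\mathbb R^2$ and a turnpike with endpoints $t,t'\in\mathbb R^2$, the travel time of a point $p$ to $f$ is $$d_{t,t'}(p,f)=\min\Big\{\|p-f\|_1,\ \|p-t\|_1+\tfrac{\|t-t'\|_2}{v}+\|t'-f\|_1,\ \|p-t'\|_1+\tfrac{\|t-t'\|_2}{v}+\|t-f\|_1\Big\}.$$ The variable-length 1-center 1-turnpike problem (VL-1C1T) asks, given $S$ and $v$, for points $f,t,t'$ that minimize $\max_{p\in S}d_{t,t'}(p,f)$ over all $f,t,t'\in\mathbb R^2$ (the length $\|t-t'\|_2$ of the turnpike is not prescribed). Theorem. The VL-1C1T problem can be solved in $O(n\log n)$ time and $O(n)$ space on the real RAM (exact real arithmetic $+,-,\times,/$, square roots, comparisons and indirectly addressed memory access at unit cost; space is the number of memory cells). That is, there are a single program and functions $T(n)=O(n\log n)$ and $M(n)=O(n)$ such that, for every $n\ge 1$, every such $S$ and every $v>1$, the program on input $(S,v)$ halts after at most $T(n)$ steps, accesses only memory cells with addresses less than $M(n)$, and outputs an optimal triple $(f,t,t')$.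 -/

import Mathlib

/-! ## The variable-length 1-center 1-turnpike problem -/

namespace Turnpike

/-- The `L₁` distance in the plane. -/
def l1Dist (p q : ℝ × ℝ) : ℝ := |p.1 - q.1| + |p.2 - q.2|

/-- The Euclidean distance in the plane. -/
noncomputable def l2Dist (p q : ℝ × ℝ) : ℝ :=
  Real.sqrt ((p.1 - q.1) ^ 2 + (p.2 - q.2) ^ 2)

/-- Travel time from the demand point `p` to the facility `f` when the turnpike has endpoints
`t`, `t'` and speed `v`: either walk, or use the turnpike in one of its two directions. -/
noncomputable def travelTime (v : ℝ) (f t t' p : ℝ × ℝ) : ℝ :=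
  min (l1Dist p f)
    (min (l1Dist p t + l2Dist t t' / v + l1Dist t' f)
      (l1Dist p t' + l2Dist t t' / v + l1Dist t f))

/-- The largest travel time of a demand point (a maximum over a finite set; used for `0 < n`). -/
noncomputable def radius {n : ℕ} (v : ℝ) (S : Fin n → ℝ × ℝ) (f t t' : ℝ × ℝ) : ℝ :=
  ⨆ i, travelTime v f t t' (S i)

/-- The facility `f` and the turnpike with endpoints `t`, `t'` minimize the largest travel time
among all facilities and all turnpikes, of any length. -/
def IsOptimal {n : ℕ} (v : ℝ) (S : Fin n → ℝ × ℝ) (f t t' : ℝ × ℝ) : Prop :=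
  ∀ g s s' : ℝ × ℝ, radius v S f t t' ≤ radius v S g s s'

end Turnpike

/-! ## The real RAM -/

namespace RealRAM

/-- Contents of the real registers, the index registers (natural numbers), the real memory
and the index memory. A program mentions only finitely many registers. -/
structure State where
  rreg : ℕ → ℝ
  ireg : ℕ → ℕ
  rmem : ℕ → ℝ
  imem : ℕ → ℕ

/-- Expressions over index registers. There is no multiplication and no way to turn a real
number into an index. -/
inductive IExp where
  | const (k : ℕ)
  | reg (i : ℕ)
  | add (a b : IExp)
  | sub (a b : IExp)

namespace IExp

/-- Value of an index expression (subtraction is truncated at `0`). -/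
def eval (s : State) : IExp → ℕ
  | const k => k
  | reg i => s.ireg i
  | add a b => a.eval s + b.eval s
  | sub a b => a.eval s - b.eval s

/-- Unit cost for every constant, register access and operation. -/
def cost : IExp → ℕ
  | const _ => 1
  | reg _ => 1
  | add a b => a.cost + b.cost + 1
  | sub a b => a.cost + b.cost + 1

end IExp

/-- Expressions over real registers: rational constants, the four arithmetic operations and
square roots. -/
inductive RExp where
  | const (q : ℚ)
  | reg (i : ℕ)
  | add (a b : RExp)
  | sub (a b : RExp)
  | mul (a b : RExp)
  | div (a b : RExp)
  | sqrt (a : RExp)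

namespace RExp

/-- Exact real arithmetic. Division by zero and the square root of a negative number
return `0`. -/
noncomputable def eval (s : State) : RExp → ℝ
  | const q => (q : ℝ)
  | reg i => s.rreg i
  | add a b => a.eval s + b.eval s
  | sub a b => a.eval s - b.eval s
  | mul a b => a.eval s * b.eval s
  | div a b => a.eval s / b.eval s
  | sqrt a => Real.sqrt (a.eval s)

/-- Unit cost for every constant, register access and operation. -/
def cost : RExp → ℕ
  | const _ => 1
  | reg _ => 1
  | add a b => a.cost + b.cost + 1
  | sub a b => a.cost + b.cost + 1
  | mul a b => a.cost + b.cost + 1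
  | div a b => a.cost + b.cost + 1
  | sqrt a => a.cost + 1

end RExp

/-- Tests: comparisons of reals and of indices, and their Boolean combinations. -/
inductive Test where
  | rle (a b : RExp)
  | ile (a b : IExp)
  | not (b : Test)
  | and (b c : Test)

namespace Test

/-- Truth of a test in a state. -/
def Holds (s : State) : Test → Prop
  | rle a b => a.eval s ≤ b.eval s
  | ile a b => a.eval s ≤ b.eval s
  | not b => ¬ b.Holds s
  | and b c => b.Holds s ∧ c.Holds s

/-- Unit cost for every comparison and connective, besides the cost of the operands. -/
def cost : Test → ℕ
  | rle a b => a.cost + b.cost + 1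
  | ile a b => a.cost + b.cost + 1
  | not b => b.cost + 1
  | and b c => b.cost + c.cost + 1

end Test

/-- Programs: register assignments, indirect loads and stores, sequencing, branching and
while loops. -/
inductive Cmd where
  | skip
  | rset (r : ℕ) (e : RExp)
  | iset (r : ℕ) (e : IExp)
  | rload (r : ℕ) (addr : IExp)
  | rstore (addr : IExp) (e : RExp)
  | iload (r : ℕ) (addr : IExp)
  | istore (addr : IExp) (e : IExp)
  | seq (c d : Cmd)
  | ite (b : Test) (c d : Cmd)
  | while (b : Test) (c : Cmd)

/-- `Exec M c s k s'`: on a machine whose two memories have `M` cells each, with addresses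
`0, …, M - 1`, the program `c` started in state `s` halts in state `s'` after exactly `k` steps.
An access to an address outside that range is an error: no execution exists for it. -/
inductive Exec (M : ℕ) : Cmd → State → ℕ → State → Prop
  | skip (s : State) : Exec M .skip s 1 s
  | rset (s : State) (r : ℕ) (e : RExp) :
      Exec M (.rset r e) s (e.cost + 1)
        { s with rreg := Function.update s.rreg r (e.eval s) }
  | iset (s : State) (r : ℕ) (e : IExp) :
      Exec M (.iset r e) s (e.cost + 1)
        { s with ireg := Function.update s.ireg r (e.eval s) }
  | rload (s : State) (r : ℕ) (a : IExp) (ha : a.eval s < M) :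
      Exec M (.rload r a) s (a.cost + 1)
        { s with rreg := Function.update s.rreg r (s.rmem (a.eval s)) }
  | rstore (s : State) (a : IExp) (e : RExp) (ha : a.eval s < M) :
      Exec M (.rstore a e) s (a.cost + e.cost + 1)
        { s with rmem := Function.update s.rmem (a.eval s) (e.eval s) }
  | iload (s : State) (r : ℕ) (a : IExp) (ha : a.eval s < M) :
      Exec M (.iload r a) s (a.cost + 1)
        { s with ireg := Function.update s.ireg r (s.imem (a.eval s)) }
  | istore (s : State) (a : IExp) (e : IExp) (ha : a.eval s < M) :
      Exec M (.istore a e) s (a.cost + e.cost + 1)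
        { s with imem := Function.update s.imem (a.eval s) (e.eval s) }
  | seq {c d : Cmd} {s s' s'' : State} {k l : ℕ}
      (hc : Exec M c s k s') (hd : Exec M d s' l s'') :
      Exec M (.seq c d) s (k + l) s''
  | iteTrue {b : Test} {c d : Cmd} {s s' : State} {k : ℕ}
      (hb : b.Holds s) (hc : Exec M c s k s') :
      Exec M (.ite b c d) s (b.cost + 1 + k) s'
  | iteFalse {b : Test} {c d : Cmd} {s s' : State} {k : ℕ}
      (hb : ¬ b.Holds s) (hd : Exec M d s k s') :
      Exec M (.ite b c d) s (b.cost + 1 + k) s'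
  | whileTrue {b : Test} {c : Cmd} {s s' s'' : State} {k l : ℕ}
      (hb : b.Holds s) (hc : Exec M c s k s') (hw : Exec M (.while b c) s' l s'') :
      Exec M (.while b c) s (b.cost + 1 + k + l) s''
  | whileFalse {b : Test} {c : Cmd} {s : State} (hb : ¬ b.Holds s) :
      Exec M (.while b c) s (b.cost + 1) s

/-- The machine is deterministic: the running time and the final state are determined by the
program and the initial state. -/
theorem Exec.det {M : ℕ} {c : Cmd} {s s₁ s₂ : State} {k₁ k₂ : ℕ}
    (h₁ : Exec M c s k₁ s₁) (h₂ : Exec M c s k₂ s₂) : k₁ = k₂ ∧ s₁ = s₂ := by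
  induction h₁ generalizing k₂ s₂ with
  | seq _ _ ih1 ih2 =>
    cases h₂ with
    | seq a b =>
      obtain ⟨rfl, rfl⟩ := ih1 a
      obtain ⟨rfl, rfl⟩ := ih2 b
      exact ⟨rfl, rfl⟩
  | iteTrue hb _ ih =>
    cases h₂ with
    | iteTrue _ a =>
      obtain ⟨rfl, rfl⟩ := ih a
      exact ⟨rfl, rfl⟩
    | iteFalse hb' _ => exact absurd hb hb'
  | iteFalse hb _ ih =>
    cases h₂ with
    | iteFalse _ a =>
      obtain ⟨rfl, rfl⟩ := ih a
      exact ⟨rfl, rfl⟩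
    | iteTrue hb' _ => exact absurd hb' hb
  | whileTrue hb _ _ ih1 ih2 =>
    cases h₂ with
    | whileTrue _ a b =>
      obtain ⟨rfl, rfl⟩ := ih1 a
      obtain ⟨rfl, rfl⟩ := ih2 b
      exact ⟨rfl, rfl⟩
    | whileFalse hb' => exact absurd hb hb'
  | whileFalse hb =>
    cases h₂ with
    | whileTrue hb' _ _ => exact absurd hb' hb
    | whileFalse _ => exact ⟨rfl, rfl⟩
  | _ => cases h₂; exact ⟨rfl, rfl⟩

/-- Initial state for the demand points `S` and the speed `v`: the real register `0` holds `v`,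
the index register `0` holds `n`, the real memory cells `2 * i` and `2 * i + 1` hold the
coordinates of the `i`-th point, and everything else is `0`. -/
noncomputable def input {n : ℕ} (S : Fin n → ℝ × ℝ) (v : ℝ) : State where
  rreg := fun j => if j = 0 then v else 0
  ireg := fun j => if j = 0 then n else 0
  rmem := fun a =>
    if h : a / 2 < n then (if a % 2 = 0 then (S ⟨a / 2, h⟩).1 else (S ⟨a / 2, h⟩).2) else 0
  imem := fun _ => 0

/-- The point whose coordinates are held by the real registers `2 * j` and `2 * j + 1`. -/
def State.point (s : State) (j : ℕ) : ℝ × ℝ := (s.rreg (2 * j), s.rreg (2 * j + 1))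

end RealRAM

/-!
The map `(x, y) ↦ (x + y, x - y)` turns `L₁` balls into axis-parallel squares. A turnpike is useful
in one direction only, so it may be translated until it ends at the facility
(`exists_turnpike_to_facility`). A solution of value `R` is then a cover of the points by a square
of radius `R` around the facility and a square of radius `R - δ` around the other endpoint of the
turnpike, where `δ` is the time spent on the turnpike.

Let the bounding box of the points be `[0, W] × [0, H]` and `2 * R < max W H`, since otherwise
walking suffices. After a reflection of the box, the facility square may be assumed to serve exactly
the points whose *key* `max x y` is at most `2 * R` (`TwoSquareCover.exists_corner`). The others use
the turnpike. Because `v > 1`, the turnpike may start at the center of a smallest square around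
their bounding box: moving it there shrinks the square faster than it lengthens the trip
(`sq_add_sq_shift_le`). For a fixed set of turnpike users it remains to find the least radius that
is at least some explicit bound and for which the turnpike is short enough. By continuity this is
the bound itself or a root of one of two linear and one quadratic equations
(`Data.exists_candidate`), so four candidates suffice, and each candidate yields a valid solution
(`Data.time_le_value`).

Hence, for each of the four corners, it suffices to turn the points into turnpike users by
decreasing key and to evaluate four candidates after each step. No sorting is necessary: the
remaining keys are kept in a tournament tree with `2 * n` nodes, from which the maximum is removed
in `O(log n)` steps (`descend_spec`, `ascend_spec`). The invariant `MainInv` says that a radius `R`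
attainable at the corner has been matched once all remaining keys are at most `2 * R`.

Programs are verified with the total-correctness predicate `Runs`, which bounds the number of steps,
a weakest-precondition calculus for code without loops and a rule for loops with a decreasing
measure.
-/

/-! ### Total correctness with time bounds -/

namespace RealRAM

/-- The command halts within `T` steps in a state that satisfies `Q`. -/
def Runs (M : ℕ) (c : Cmd) (s : State) (T : ℕ) (Q : State → Prop) : Prop :=
  ∃ (k : ℕ) (s' : State), k ≤ T ∧ Exec M c s k s' ∧ Q s'

theorem Runs.mono {M : ℕ} {c : Cmd} {s : State} {T T' : ℕ} {Q Q' : State → Prop}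
    (h : Runs M c s T Q) (hT : T ≤ T') (hQ : ∀ s', Q s' → Q' s') : Runs M c s T' Q' := by
  obtain ⟨k, s', hk, he, hq⟩ := h
  exact ⟨k, s', hk.trans hT, he, hQ _ hq⟩

theorem Runs.seq {M : ℕ} {c d : Cmd} {s : State} {T T' : ℕ} {P Q : State → Prop}
    (h : Runs M c s T P) (h' : ∀ s', P s' → Runs M d s' T' Q) :
    Runs M (.seq c d) s (T + T') Q := by
  obtain ⟨k, s', hk, he, hp⟩ := h
  obtain ⟨k', s'', hk', he', hq⟩ := h' s' hp
  exact ⟨k + k', s'', add_le_add hk hk', .seq he he', hq⟩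

/-- A loop whose body takes at most `t` steps, preserves `I` and decreases the measure `μ`. -/
theorem Runs.while_loop {M : ℕ} {b : Test} {c : Cmd} {t : ℕ} (I : State → Prop) (μ : State → ℕ)
    (hstep : ∀ s, I s → b.Holds s → Runs M c s t fun s' => I s' ∧ μ s' < μ s) :
    ∀ (N : ℕ) (s : State), I s → μ s ≤ N →
      Runs M (.while b c) s (N * (b.cost + 1 + t) + (b.cost + 1))
        fun s' => I s' ∧ ¬ b.Holds s' := by
  intro N
  induction N with
  | zero =>
    intro s hI hμ
    by_cases hb : b.Holds s
    · obtain ⟨_, s', _, _, _, h⟩ := hstep s hI hb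
      omega
    · exact ⟨_, s, by omega, .whileFalse hb, hI, hb⟩
  | succ N ih =>
    intro s hI hμ
    by_cases hb : b.Holds s
    · obtain ⟨k, s', hk, he, hI', h⟩ := hstep s hI hb
      obtain ⟨k', s'', hk', he', hq⟩ := ih s' hI' (by omega)
      refine ⟨_, s'', ?_, .whileTrue hb he he', hq⟩
      rw [Nat.succ_mul]
      omega
    · exact ⟨_, s, by omega, .whileFalse hb, hI, hb⟩

/-- Weakest precondition of a command without loops (and `False` for loops). -/
def wp (M : ℕ) : Cmd → (State → Prop) → State → Prop
  | .skip, Q, s => Q s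
  | .rset r e, Q, s => Q { s with rreg := Function.update s.rreg r (e.eval s) }
  | .iset r e, Q, s => Q { s with ireg := Function.update s.ireg r (e.eval s) }
  | .rload r a, Q, s => a.eval s < M ∧
      Q { s with rreg := Function.update s.rreg r (s.rmem (a.eval s)) }
  | .rstore a e, Q, s => a.eval s < M ∧
      Q { s with rmem := Function.update s.rmem (a.eval s) (e.eval s) }
  | .iload r a, Q, s => a.eval s < M ∧
      Q { s with ireg := Function.update s.ireg r (s.imem (a.eval s)) }
  | .istore a e, Q, s => a.eval s < M ∧
      Q { s with imem := Function.update s.imem (a.eval s) (e.eval s) }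
  | .seq c d, Q, s => wp M c (wp M d Q) s
  | .ite b c d, Q, s => (b.Holds s → wp M c Q s) ∧ (¬ b.Holds s → wp M d Q s)
  | .while _ _, _, _ => False

/-- Bound for the running time of a command without loops (and the junk value `0` for loops). -/
def Cmd.worst : Cmd → ℕ
  | .skip => 1
  | .rset _ e => e.cost + 1
  | .iset _ e => e.cost + 1
  | .rload _ a => a.cost + 1
  | .rstore a e => a.cost + e.cost + 1
  | .iload _ a => a.cost + 1
  | .istore a e => a.cost + e.cost + 1
  | .seq c d => c.worst + d.worst
  | .ite b c d => b.cost + 1 + max c.worst d.worst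
  | .while _ _ => 0

theorem wp.runs {M : ℕ} : ∀ {c : Cmd} {Q : State → Prop} {s : State},
    wp M c Q s → Runs M c s c.worst Q := by
  intro c
  induction c with
  | skip => exact fun h => ⟨_, _, le_rfl, .skip _, h⟩
  | rset r e => exact fun h => ⟨_, _, le_rfl, .rset _ _ _, h⟩
  | iset r e => exact fun h => ⟨_, _, le_rfl, .iset _ _ _, h⟩
  | rload r a => exact fun h => ⟨_, _, le_rfl, .rload _ _ _ h.1, h.2⟩
  | rstore a e => exact fun h => ⟨_, _, le_rfl, .rstore _ _ _ h.1, h.2⟩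
  | iload r a => exact fun h => ⟨_, _, le_rfl, .iload _ _ _ h.1, h.2⟩
  | istore a e => exact fun h => ⟨_, _, le_rfl, .istore _ _ _ h.1, h.2⟩
  | seq c d ihc ihd => exact fun h => (ihc h).seq fun s' h' => ihd h'
  | ite b c d ihc ihd =>
    intro Q s h
    by_cases hb : b.Holds s
    · obtain ⟨k, s', hk, he, hq⟩ := ihc (h.1 hb)
      exact ⟨_, s', add_le_add_right (hk.trans (le_max_left _ _)) _, .iteTrue hb he, hq⟩
    · obtain ⟨k, s', hk, he, hq⟩ := ihd (h.2 hb)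
      exact ⟨_, s', add_le_add_right (hk.trans (le_max_right _ _)) _, .iteFalse hb he, hq⟩
  | _ => exact fun h => h.elim

theorem wp.mono {M : ℕ} : ∀ {c : Cmd} {Q Q' : State → Prop} {s : State},
    wp M c Q s → (∀ s', Q s' → Q' s') → wp M c Q' s := by
  intro c
  induction c with
  | skip => exact fun h hq => hq _ h
  | rset r e => exact fun h hq => hq _ h
  | iset r e => exact fun h hq => hq _ h
  | rload r a => exact fun h hq => ⟨h.1, hq _ h.2⟩
  | rstore a e => exact fun h hq => ⟨h.1, hq _ h.2⟩
  | iload r a => exact fun h hq => ⟨h.1, hq _ h.2⟩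
  | istore a e => exact fun h hq => ⟨h.1, hq _ h.2⟩
  | seq c d ihc ihd => exact fun h hq => ihc h fun s' h' => ihd h' hq
  | ite b c d ihc ihd =>
    exact fun h hq => ⟨fun hb => ihc (h.1 hb) hq, fun hb => ihd (h.2 hb) hq⟩
  | _ => exact fun h _ => h.elim

/-- The commands of a list, one after the other. -/
def Cmd.block : List Cmd → Cmd
  | [] => .skip
  | c :: l => .seq c (Cmd.block l)

@[simp] theorem wp_block_nil {M : ℕ} {Q : State → Prop} {s : State} :
    wp M (Cmd.block []) Q s ↔ Q s := Iff.rfl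

@[simp] theorem wp_block_cons {M : ℕ} {c : Cmd} {l : List Cmd} {Q : State → Prop} {s : State} :
    wp M (Cmd.block (c :: l)) Q s ↔ wp M c (wp M (Cmd.block l) Q) s := Iff.rfl

instance : Add IExp := ⟨.add⟩
instance : Sub IExp := ⟨.sub⟩
instance : Add RExp := ⟨.add⟩
instance : Sub RExp := ⟨.sub⟩
instance : Mul RExp := ⟨.mul⟩
instance : Div RExp := ⟨.div⟩
/-- `max a b = (a + b + √(a - b)²) / 2`. -/
instance : Max RExp := ⟨fun a b => (a + b + .sqrt ((a - b) * (a - b))) / .const 2⟩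
/-- `min a b = (a + b - √(a - b)²) / 2`. -/
instance : Min RExp := ⟨fun a b => (a + b - .sqrt ((a - b) * (a - b))) / .const 2⟩

@[simp] theorem IExp.eval_const (s : State) (k : ℕ) : (IExp.const k).eval s = k := rfl
@[simp] theorem IExp.eval_reg (s : State) (i : ℕ) : (IExp.reg i).eval s = s.ireg i := rfl
@[simp] theorem IExp.eval_add (s : State) (a b : IExp) : (a + b).eval s = a.eval s + b.eval s :=
  rfl
@[simp] theorem IExp.eval_sub (s : State) (a b : IExp) : (a - b).eval s = a.eval s - b.eval s :=
  rfl
@[simp] theorem RExp.eval_const (s : State) (q : ℚ) : (RExp.const q).eval s = q := rfl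
@[simp] theorem RExp.eval_reg (s : State) (i : ℕ) : (RExp.reg i).eval s = s.rreg i := rfl
@[simp] theorem RExp.eval_sqrt (s : State) (a : RExp) :
    (RExp.sqrt a).eval s = Real.sqrt (a.eval s) := rfl
@[simp] theorem RExp.eval_add (s : State) (a b : RExp) : (a + b).eval s = a.eval s + b.eval s :=
  rfl
@[simp] theorem RExp.eval_sub (s : State) (a b : RExp) : (a - b).eval s = a.eval s - b.eval s :=
  rfl
@[simp] theorem RExp.eval_mul (s : State) (a b : RExp) : (a * b).eval s = a.eval s * b.eval s :=
  rfl
@[simp] theorem RExp.eval_div (s : State) (a b : RExp) : (a / b).eval s = a.eval s / b.eval s :=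
  rfl

@[simp] theorem RExp.eval_max (s : State) (a b : RExp) :
    (max a b).eval s = max (a.eval s) (b.eval s) := by
  change (a.eval s + b.eval s + Real.sqrt ((a.eval s - b.eval s) * (a.eval s - b.eval s))) /
    ((2 : ℚ) : ℝ) = _
  rw [Real.sqrt_mul_self_eq_abs]
  rcases le_total (a.eval s) (b.eval s) with h | h
  · rw [max_eq_right h, abs_of_nonpos (sub_nonpos.2 h)]
    push_cast
    ring
  · rw [max_eq_left h, abs_of_nonneg (sub_nonneg.2 h)]
    push_cast
    ring

@[simp] theorem RExp.eval_min (s : State) (a b : RExp) :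
    (min a b).eval s = min (a.eval s) (b.eval s) := by
  change (a.eval s + b.eval s - Real.sqrt ((a.eval s - b.eval s) * (a.eval s - b.eval s))) /
    ((2 : ℚ) : ℝ) = _
  rw [Real.sqrt_mul_self_eq_abs]
  rcases le_total (a.eval s) (b.eval s) with h | h
  · rw [min_eq_left h, abs_of_nonpos (sub_nonpos.2 h)]
    push_cast
    ring
  · rw [min_eq_right h, abs_of_nonneg (sub_nonneg.2 h)]
    push_cast
    ring

end RealRAM

/-! ### Rotated coordinates and reduction to one direction of travel -/

namespace Turnpike

/-- The map `p ↦ (p.1 + p.2, p.1 - p.2)` turns the `L₁` distance into the maximum distance. -/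
theorem l1Dist_eq_max (p q : ℝ × ℝ) :
    l1Dist p q = max |(p.1 + p.2) - (q.1 + q.2)| |(p.1 - p.2) - (q.1 - q.2)| := by
  have h1 : (p.1 + p.2) - (q.1 + q.2) = (p.1 - q.1) + (p.2 - q.2) := by ring
  have h2 : (p.1 - p.2) - (q.1 - q.2) = (p.1 - q.1) - (p.2 - q.2) := by ring
  rw [h1, h2, l1Dist]
  generalize p.1 - q.1 = x
  generalize p.2 - q.2 = y
  apply le_antisymm
  · rcases abs_cases x with ⟨h, _⟩ | ⟨h, _⟩ <;> rcases abs_cases y with ⟨h', _⟩ | ⟨h', _⟩ <;>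
      rw [h, h', le_max_iff]
    · exact .inl (le_abs_self _)
    · exact .inr (le_trans (by linarith) (le_abs_self _))
    · exact .inr (le_trans (by linarith) (neg_le_abs _))
    · exact .inl (le_trans (by linarith) (neg_le_abs _))
  · exact max_le (abs_add_le x y) (abs_sub x y)

theorem l2Dist_eq_sqrt (p q : ℝ × ℝ) :
    l2Dist p q = Real.sqrt ((((p.1 + p.2) - (q.1 + q.2)) ^ 2 +
      ((p.1 - p.2) - (q.1 - q.2)) ^ 2) / 2) := by
  rw [l2Dist]
  congr 1
  ring

theorem l1Dist_triangle (p q r : ℝ × ℝ) : l1Dist p r ≤ l1Dist p q + l1Dist q r := by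
  have h1 := abs_sub_le p.1 q.1 r.1
  have h2 := abs_sub_le p.2 q.2 r.2
  unfold l1Dist
  linarith

theorem l2Dist_comm (p q : ℝ × ℝ) : l2Dist p q = l2Dist q p := by
  simp only [l2Dist, sub_sq_comm]

theorem l2Dist_nonneg (p q : ℝ × ℝ) : 0 ≤ l2Dist p q := Real.sqrt_nonneg _

/-- Every turnpike can be replaced by one that ends at the facility: only the direction towards
the endpoint closer to the facility is of use, and the turnpike may be translated by the walk
that follows it. -/
theorem exists_turnpike_to_facility {v : ℝ} (hv : 0 < v) (f t t' : ℝ × ℝ) :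
    ∃ e : ℝ × ℝ, ∀ p, min (l1Dist p f) (l1Dist p e + l2Dist e f / v) ≤ travelTime v f t t' p := by
  have key : ∀ t t' : ℝ × ℝ, l1Dist t' f ≤ l1Dist t f → ∃ e : ℝ × ℝ, ∀ p,
      min (l1Dist p f) (l1Dist p e + l2Dist e f / v) ≤ travelTime v f t t' p := by
    intro t t' h
    refine ⟨t + f - t', fun p => ?_⟩
    have h0 : 0 ≤ l2Dist t t' / v := div_nonneg (l2Dist_nonneg _ _) hv.le
    have h1 : l1Dist p (t + f - t') ≤ l1Dist p t + l1Dist t' f := by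
      refine (l1Dist_triangle p t _).trans (le_of_eq ?_)
      simp only [l1Dist, Prod.fst_sub, Prod.snd_sub, Prod.fst_add, Prod.snd_add]
      congr 2 <;> congr 1 <;> ring
    have h2 : l2Dist (t + f - t') f = l2Dist t t' := by
      simp only [l2Dist, Prod.fst_sub, Prod.snd_sub, Prod.fst_add, Prod.snd_add]
      congr 2 <;> ring
    have h3 := l1Dist_triangle p t' f
    rw [h2]
    refine le_min (min_le_left _ _) (le_min ?_ ?_)
    · exact (min_le_right _ _).trans (by linarith)
    · exact (min_le_left _ _).trans (by linarith)
  rcases le_total (l1Dist t' f) (l1Dist t f) with h | h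
  · exact key t t' h
  · obtain ⟨e, he⟩ := key t' t h
    refine ⟨e, fun p => (he p).trans (le_of_eq ?_)⟩
    rw [travelTime, travelTime, l2Dist_comm t' t]
    congr 1
    exact min_comm _ _

/-- The radius is bounded by every common bound of the travel times. -/
theorem radius_le {n : ℕ} (hn : 0 < n) {v : ℝ} {S : Fin n → ℝ × ℝ} {f t t' : ℝ × ℝ} {r : ℝ}
    (h : ∀ i, travelTime v f t t' (S i) ≤ r) : radius v S f t t' ≤ r :=
  haveI : Nonempty (Fin n) := ⟨⟨0, hn⟩⟩
  ciSup_le h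

theorem travelTime_le_radius {n : ℕ} (v : ℝ) (S : Fin n → ℝ × ℝ) (f t t' : ℝ × ℝ) (i : Fin n) :
    travelTime v f t t' (S i) ≤ radius v S f t t' :=
  le_ciSup (f := fun i => travelTime v f t t' (S i)) (Set.finite_range _).bddAbove i

/-! ### Two squares covering a box -/

/-- The bounding box `[b₁, b₂] × [d₁, d₂]` of the points `(X i, Y i)` with `i ∈ D`, all of which
lie in `[0, W] × [0, H]`. For empty `D` it is the inverted box `[W, 0] × [H, 0]`. -/
structure IsBox {ι : Type*} (X Y : ι → ℝ) (W H : ℝ) (D : Set ι) (b₁ b₂ d₁ d₂ : ℝ) : Prop where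
  left : ∀ i ∈ D, b₁ ≤ X i
  right : ∀ i ∈ D, X i ≤ b₂
  bottom : ∀ i ∈ D, d₁ ≤ Y i
  top : ∀ i ∈ D, Y i ≤ d₂
  le_left : ∀ z ≤ W, (∀ i ∈ D, z ≤ X i) → z ≤ b₁
  right_le : ∀ z, 0 ≤ z → (∀ i ∈ D, X i ≤ z) → b₂ ≤ z
  le_bottom : ∀ z ≤ H, (∀ i ∈ D, z ≤ Y i) → z ≤ d₁
  top_le : ∀ z, 0 ≤ z → (∀ i ∈ D, Y i ≤ z) → d₂ ≤ z
  left_le : b₁ ≤ W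
  zero_le_right : 0 ≤ b₂
  bottom_le : d₁ ≤ H
  zero_le_top : 0 ≤ d₂

/-- Half of the longer side of the box `[b₁, b₂] × [d₁, d₂]`, that is, the radius of the smallest
square that contains it. The centers of these squares form the box
`[b₂ - ρ, b₁ + ρ] × [d₂ - ρ, d₁ + ρ]`. -/
noncomputable def halfSide (b₁ b₂ d₁ d₂ : ℝ) : ℝ := max (b₂ - b₁) (d₂ - d₁) / 2

/-- Conditions on a radius `R` under which the following cover succeeds: the box
`[b₁, b₂] × [d₁, d₂]` is reached through the turnpike by a smallest enclosing square, and
`[0, min (2 * R) W] × [0, min (2 * R) H]` is covered by a square of radius `R` around the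
facility. The last condition says that the distance of `(R, R)` to the quadrants above and to
the right of the centers of the first square is small enough. -/
structure Feasible (v W H R b₁ b₂ d₁ d₂ : ℝ) : Prop where
  halfSide_le : halfSide b₁ b₂ d₁ d₂ ≤ R
  width : min (2 * R) W ≤ R + (b₁ + halfSide b₁ b₂ d₁ d₂)
  height : min (2 * R) H ≤ R + (d₁ + halfSide b₁ b₂ d₁ d₂)
  dist : max 0 (b₂ - halfSide b₁ b₂ d₁ d₂ - R) ^ 2 + max 0 (d₂ - halfSide b₁ b₂ d₁ d₂ - R) ^ 2 ≤
    2 * (v * (R - halfSide b₁ b₂ d₁ d₂)) ^ 2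

/-- The radius `R` is attained by serving the points of the square `[0, 2 * R] × [0, 2 * R]` on
foot and all others through the turnpike. -/
structure CornerFeasible {ι : Type*} (v : ℝ) (X Y : ι → ℝ) (W H R : ℝ) : Prop where
  nonneg : 0 ≤ R
  lt : 2 * R < max W H
  feasible : ∀ b₁ b₂ d₁ d₂, IsBox X Y W H {i | 2 * R < max (X i) (Y i)} b₁ b₂ d₁ d₂ →
    Feasible v W H R b₁ b₂ d₁ d₂

variable {ι : Type*} {X Y : ι → ℝ} {W H : ℝ}

theorem IsBox.swap {D : Set ι} {b₁ b₂ d₁ d₂ : ℝ} (h : IsBox X Y W H D b₁ b₂ d₁ d₂) :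
    IsBox Y X H W D d₁ d₂ b₁ b₂ :=
  ⟨h.bottom, h.top, h.left, h.right, h.le_bottom, h.top_le, h.le_left, h.right_le, h.bottom_le,
    h.zero_le_top, h.left_le, h.zero_le_right⟩

theorem halfSide_swap (b₁ b₂ d₁ d₂ : ℝ) : halfSide b₁ b₂ d₁ d₂ = halfSide d₁ d₂ b₁ b₂ := by
  rw [halfSide, max_comm, halfSide]

theorem Feasible.swap {v R b₁ b₂ d₁ d₂ : ℝ} (h : Feasible v W H R b₁ b₂ d₁ d₂) :
    Feasible v H W R d₁ d₂ b₁ b₂ := by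
  obtain ⟨h1, h2, h3, h4⟩ := h
  rw [halfSide_swap] at h1 h2 h3 h4
  exact ⟨h1, h3, h2, by linarith⟩

theorem CornerFeasible.swap {v R : ℝ} (h : CornerFeasible v X Y W H R) :
    CornerFeasible v Y X H W R := by
  refine ⟨h.nonneg, max_comm W H ▸ h.lt, fun b₁ b₂ d₁ d₂ hb => ?_⟩
  simp only [max_comm (Y _)] at hb
  exact (h.feasible _ _ _ _ hb.swap).swap

/-- The bounding box of a set is unique. -/
theorem IsBox.unique {D : Set ι} {b₁ b₂ d₁ d₂ b₁' b₂' d₁' d₂' : ℝ}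
    (h : IsBox X Y W H D b₁ b₂ d₁ d₂) (h' : IsBox X Y W H D b₁' b₂' d₁' d₂') :
    b₁ = b₁' ∧ b₂ = b₂' ∧ d₁ = d₁' ∧ d₂ = d₂' :=
  ⟨(h'.le_left _ h.left_le h.left).antisymm (h.le_left _ h'.left_le h'.left),
    (h.right_le _ h'.zero_le_right h'.right).antisymm (h'.right_le _ h.zero_le_right h.right),
    (h'.le_bottom _ h.bottom_le h.bottom).antisymm (h.le_bottom _ h'.bottom_le h'.bottom),
    (h.top_le _ h'.zero_le_top h'.top).antisymm (h'.top_le _ h.zero_le_top h.top)⟩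

theorem IsBox.flip {D : Set ι} {b₁ b₂ d₁ d₂ : ℝ}
    (h : IsBox X (fun i => H - Y i) W H D b₁ b₂ d₁ d₂) :
    IsBox X Y W H D b₁ b₂ (H - d₂) (H - d₁) where
  left := h.left
  right := h.right
  bottom i hi := by linarith [h.top i hi]
  top i hi := by linarith [h.bottom i hi]
  le_left := h.le_left
  right_le := h.right_le
  le_bottom z hz hi := by
    linarith [h.top_le (H - z) (by linarith) fun i hD => by linarith [hi i hD]]
  top_le z hz hi := by
    linarith [h.le_bottom (H - z) (by linarith) fun i hD => by linarith [hi i hD]]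
  left_le := h.left_le
  zero_le_right := h.zero_le_right
  bottom_le := by linarith [h.zero_le_top]
  zero_le_top := by linarith [h.bottom_le]

theorem sub_halfSide_le (b₁ b₂ d₁ d₂ : ℝ) :
    b₂ - halfSide b₁ b₂ d₁ d₂ ≤ b₁ + halfSide b₁ b₂ d₁ d₂ ∧
      d₂ - halfSide b₁ b₂ d₁ d₂ ≤ d₁ + halfSide b₁ b₂ d₁ d₂ := by
  unfold halfSide
  constructor
  · linarith [le_max_left (b₂ - b₁) (d₂ - d₁)]
  · linarith [le_max_right (b₂ - b₁) (d₂ - d₁)]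

/-- Moving the turnpike entrance by `e` in both coordinates shrinks the radius needed around it by
`e`, but lengthens the turnpike by at most `e`. -/
theorem sq_add_sq_shift_le {A B e v δ : ℝ} (he : 0 ≤ e) (hv : 1 ≤ v)
    (hδ : 0 ≤ δ) (h : A ^ 2 + B ^ 2 ≤ 2 * (v * δ) ^ 2) :
    (A + e) ^ 2 + (B + e) ^ 2 ≤ 2 * (v * (δ + e)) ^ 2 := by
  have hvδ : 0 ≤ v * δ := by positivity
  have hAB : A + B ≤ 2 * (v * δ) := by
    apply abs_le_of_sq_le_sq' _ (by positivity) |>.2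
    nlinarith [sq_nonneg (A - B)]
  have h1 : (A + B) * e ≤ 2 * (v * δ) * e := mul_le_mul_of_nonneg_right hAB he
  have h2 : δ * e * v ≤ δ * e * v ^ 2 :=
    mul_le_mul_of_nonneg_left (by nlinarith) (mul_nonneg hδ he)
  have h3 : e ^ 2 * 1 ≤ e ^ 2 * v ^ 2 := mul_le_mul_of_nonneg_left (by nlinarith) (sq_nonneg e)
  nlinarith

/-- The corner is feasible if the square of radius `R'` around `(c, d)` contains all points outside
the corner square, and if in each direction one of the two centers is within `R` of the corner. In
a direction in which the square around the facility can cover all of `[0, W] × [0, H]`, the last two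
assumptions make sure that it can do so without leaving the range of the turnpike entrances. -/
theorem feasible_of_cover {v R R' a b c d : ℝ} (hv : 1 < v)
    (hW : ∃ i, X i = W) (hH : ∃ i, Y i = H)
    (hY : ∀ i, 0 ≤ Y i ∧ Y i ≤ H) (hX : ∀ i, 0 ≤ X i ∧ X i ≤ W)
    (hR : 2 * R < max W H) (hR' : R' ≤ R)
    (hdist : (a - c) ^ 2 + (b - d) ^ 2 ≤ 2 * (v * (R - R')) ^ 2)
    (hD : ∀ i, 2 * R < max (X i) (Y i) → |X i - c| ≤ R' ∧ |Y i - d| ≤ R')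
    (hac : a ≤ R ∨ c ≤ R) (hbd : b ≤ R ∨ d ≤ R) {b₁ b₂ d₁ d₂ : ℝ}
    (hbox : IsBox X Y W H {i | 2 * R < max (X i) (Y i)} b₁ b₂ d₁ d₂)
    (hw : W ≤ 2 * R → W ≤ R + (b₁ + halfSide b₁ b₂ d₁ d₂))
    (hh : H ≤ 2 * R → H ≤ R + (d₁ + halfSide b₁ b₂ d₁ d₂)) :
    Feasible v W H R b₁ b₂ d₁ d₂ := by
  obtain ⟨iW, hiW⟩ := hW
  obtain ⟨iH, hiH⟩ := hH
  obtain ⟨k, hk⟩ : ∃ k, 2 * R < max (X k) (Y k) := by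
    rcases lt_max_iff.1 hR with h | h
    · exact ⟨iW, lt_max_of_lt_left (hiW ▸ h)⟩
    · exact ⟨iH, lt_max_of_lt_right (hiH ▸ h)⟩
  have hkD := hD k hk
  simp only [abs_le] at hD hkD
  have e1 : c - R' ≤ b₁ := hbox.le_left _ (by linarith [hX k]) fun i hi => by linarith [hD i hi]
  have e2 : b₂ ≤ c + R' := hbox.right_le _ (by linarith [hX k]) fun i hi => by linarith [hD i hi]
  have e3 : d - R' ≤ d₁ := hbox.le_bottom _ (by linarith [hY k]) fun i hi => by linarith [hD i hi]
  have e4 : d₂ ≤ d + R' := hbox.top_le _ (by linarith [hY k]) fun i hi => by linarith [hD i hi]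
  have hρ : halfSide b₁ b₂ d₁ d₂ ≤ R' := by
    have := max_le (show b₂ - b₁ ≤ 2 * R' by linarith) (show d₂ - d₁ ≤ 2 * R' by linarith)
    unfold halfSide
    linarith
  have hpq := sub_halfSide_le b₁ b₂ d₁ d₂
  set ρ := halfSide b₁ b₂ d₁ d₂
  refine ⟨hρ.trans hR', ?_, ?_, ?_⟩
  · rcases le_or_gt W (2 * R) with h | h
    · exact (min_le_right _ _).trans (hw h)
    · have hb : W ≤ b₂ := by
        have := hbox.right iW (lt_max_of_lt_left (hiW ▸ h))
        linarith
      exact (min_le_left _ _).trans (by linarith)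
  · rcases le_or_gt H (2 * R) with h | h
    · exact (min_le_right _ _).trans (hh h)
    · have hb : H ≤ d₂ := by
        have := hbox.top iH (lt_max_of_lt_right (hiH ▸ h))
        linarith
      exact (min_le_left _ _).trans (by linarith)
  · have hshift := sq_add_sq_shift_le (A := |a - c|) (B := |b - d|)
      (show 0 ≤ R' - ρ by linarith) hv.le (show 0 ≤ R - R' by linarith) (by simpa using hdist)
    have g1 : max 0 (b₂ - ρ - R) ≤ |a - c| + (R' - ρ) := by
      refine max_le (add_nonneg (abs_nonneg _) (by linarith)) ?_
      rcases hac with h | h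
      · linarith [neg_abs_le (a - c)]
      · linarith [abs_nonneg (a - c)]
    have g2 : max 0 (d₂ - ρ - R) ≤ |b - d| + (R' - ρ) := by
      refine max_le (add_nonneg (abs_nonneg _) (by linarith)) ?_
      rcases hbd with h | h
      · linarith [neg_abs_le (b - d)]
      · linarith [abs_nonneg (b - d)]
    have g3 := pow_le_pow_left₀ (le_max_left _ _) g1 2
    have g4 := pow_le_pow_left₀ (le_max_left _ _) g2 2
    have : R - R' + (R' - ρ) = R - ρ := by ring
    rw [this] at hshift
    linarith

/-- The reflection of the interval `[0, W]`, or the identity. -/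
def flip (s : Bool) (W x : ℝ) : ℝ := if s then x else W - x

/-- A square of radius `R` around `(a, b)` and a square of radius `R'` around `(c, d)` cover
points that touch all sides of `[0, W] × [0, H]`. The first square belongs to the points that walk,
and `2 * (v * (R - R')) ^ 2` bounds the squared distance of the centers in rotated coordinates. -/
structure TwoSquareCover {ι : Type*} (v : ℝ) (X Y : ι → ℝ) (W H R R' a b c d : ℝ) : Prop where
  width : ∃ i, X i = W
  height : ∃ i, Y i = H
  left : ∃ i, X i = 0
  bottom : ∃ i, Y i = 0
  mem_x : ∀ i, 0 ≤ X i ∧ X i ≤ W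
  mem_y : ∀ i, 0 ≤ Y i ∧ Y i ≤ H
  le : R' ≤ R
  dist : (a - c) ^ 2 + (b - d) ^ 2 ≤ 2 * (v * (R - R')) ^ 2
  cover : ∀ i, (|X i - a| ≤ R ∧ |Y i - b| ≤ R) ∨ (|X i - c| ≤ R' ∧ |Y i - d| ≤ R')

variable {v R R' a b c d : ℝ}

theorem TwoSquareCover.swap (h : TwoSquareCover v X Y W H R R' a b c d) :
    TwoSquareCover v Y X H W R R' b a d c :=
  ⟨h.height, h.width, h.bottom, h.left, h.mem_y, h.mem_x, h.le, by linarith [h.dist],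
    fun i => (h.cover i).imp And.symm And.symm⟩

theorem TwoSquareCover.flip_right (h : TwoSquareCover v X Y W H R R' a b c d) (s : Bool) :
    TwoSquareCover v X (fun i => flip s H (Y i)) W H R R' a (flip s H b) c (flip s H d) := by
  cases s with
  | true => exact h
  | false =>
    have habs : ∀ z y : ℝ, |H - z - (H - y)| = |z - y| := fun z y => by
      rw [sub_sub_sub_cancel_left, abs_sub_comm]
    obtain ⟨i, hi⟩ := h.height
    obtain ⟨j, hj⟩ := h.bottom
    refine ⟨h.width, ⟨j, by simp [flip, hj]⟩, h.left, ⟨i, by simp [flip, hi]⟩, h.mem_x,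
      fun i => ?_, h.le, ?_, fun i => ?_⟩
    · have := h.mem_y i
      constructor <;> simp [flip] <;> linarith
    · have := h.dist
      simp only [flip]
      norm_num
      linarith [sub_sq_comm b d]
    · simpa only [flip, Bool.false_eq_true, if_false, habs] using h.cover i

theorem TwoSquareCover.flip_left (h : TwoSquareCover v X Y W H R R' a b c d) (s : Bool) :
    TwoSquareCover v (fun i => flip s W (X i)) Y W H R R' (flip s W a) b (flip s W c) d :=
  (h.swap.flip_right s).swap

theorem TwoSquareCover.nonneg (h : TwoSquareCover v X Y W H R R' a b c d) : 0 ≤ R := by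
  obtain ⟨i, _⟩ := h.width
  rcases h.cover i with h' | h'
  · exact (abs_nonneg _).trans h'.1
  · exact ((abs_nonneg _).trans h'.1).trans h.le

/-- The left side of the box is reached by the square of the facility if this square is further to
the left. -/
theorem TwoSquareCover.facility_le (h : TwoSquareCover v X Y W H R R' a b c d) (hac : a ≤ c) :
    a ≤ R := by
  obtain ⟨i, hi⟩ := h.left
  have := h.le
  rcases h.cover i with ⟨h', _⟩ | ⟨h', _⟩ <;> rw [hi, abs_le] at h' <;> linarith

/-- In each direction at least one of the centers is close to the side. -/
theorem TwoSquareCover.center_le (h : TwoSquareCover v X Y W H R R' a b c d) :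
    b ≤ R ∨ d ≤ R := by
  obtain ⟨i, hi⟩ := h.bottom
  have := h.le
  rcases h.cover i with ⟨_, h'⟩ | ⟨_, h'⟩ <;> rw [hi, abs_le] at h'
  · left; linarith
  · right; linarith

/-- If the box is wide but not high, then the turnpike takes the points at the right. Whether the
facility is to be put into the lower or the upper corner depends on the position of their bounding
box. -/
theorem TwoSquareCover.exists_corner_of_wide (h : TwoSquareCover v X Y W H R R' a b c d)
    (hv : 1 < v) (hac : a ≤ c) (hW : 2 * R < W) (hH : H ≤ 2 * R) :
    ∃ s, CornerFeasible v X (fun i => flip s H (Y i)) W H R := by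
  have haR := h.facility_le hac
  have hmax : 2 * R < max W H := lt_max_of_lt_left hW
  have hset : ∀ s i, 2 * R < max (X i) (flip s H (Y i)) ↔ 2 * R < X i := by
    intro s i
    have := ((h.flip_right s).mem_y i).2
    rw [lt_max_iff, or_iff_left (by linarith)]
  have hD : ∀ s i, 2 * R < max (X i) (flip s H (Y i)) →
      |X i - c| ≤ R' ∧ |flip s H (Y i) - flip s H d| ≤ R' := by
    intro s i hi
    rw [hset] at hi
    refine ((h.flip_right s).cover i).resolve_left fun h' => ?_
    have := abs_le.1 h'.1
    linarith
  by_cases hlow : ∃ b₁ b₂ d₁ d₂, IsBox X Y W H {i | 2 * R < X i} b₁ b₂ d₁ d₂ ∧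
      R + (d₁ + halfSide b₁ b₂ d₁ d₂) < H
  · refine ⟨false, h.nonneg, hmax, fun b₁ b₂ d₁ d₂ hbox => ?_⟩
    have h' := h.flip_right false
    refine feasible_of_cover hv h'.width h'.height h'.mem_y h'.mem_x hmax h.le h'.dist (hD false)
      (.inl haR) h'.center_le hbox (fun hw => absurd hW (by linarith)) fun _ => ?_
    simp only [hset] at hbox
    obtain ⟨b₁', b₂', d₁', d₂', hbox', hlt⟩ := hlow
    obtain ⟨rfl, rfl, rfl, rfl⟩ := hbox'.unique (IsBox.flip hbox)
    have hside : halfSide b₁' b₂' d₁ d₂ = halfSide b₁' b₂' (H - d₂) (H - d₁) := by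
      simp only [halfSide]
      congr 2
      ring
    have := (sub_halfSide_le b₁' b₂' (H - d₂) (H - d₁)).2
    rw [hside]
    linarith
  · refine ⟨true, h.nonneg, hmax, fun b₁ b₂ d₁ d₂ hbox => ?_⟩
    refine feasible_of_cover hv h.width h.height h.mem_y h.mem_x hmax h.le h.dist (hD true)
      (.inl haR) h.center_le hbox (fun hw => absurd hW (by linarith)) fun _ => ?_
    simp only [hset] at hbox
    by_contra hlt
    exact hlow ⟨_, _, _, _, hbox, not_le.1 hlt⟩

/-- If both sides are long, then the facility belongs into the corner opposite to the
turnpike entrance. -/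
theorem TwoSquareCover.corner_of_large (h : TwoSquareCover v X Y W H R R' a b c d)
    (hv : 1 < v) (hac : a ≤ c) (hbd : b ≤ d) (hW : 2 * R < W) (hH : 2 * R < H) :
    CornerFeasible v X Y W H R := by
  have haR := h.facility_le hac
  have hbR := h.swap.facility_le hbd
  have hmax : 2 * R < max W H := lt_max_of_lt_left hW
  refine ⟨h.nonneg, hmax, fun b₁ b₂ d₁ d₂ hbox => ?_⟩
  refine feasible_of_cover hv h.width h.height h.mem_y h.mem_x hmax h.le h.dist (fun i hi => ?_)
      (.inl haR) (.inl hbR) hbox (fun hw => absurd hW (by linarith))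
      (fun hw => absurd hH (by linarith))
  refine (h.cover i).resolve_left fun h' => ?_
  have h1 := abs_le.1 h'.1
  have h2 := abs_le.1 h'.2
  rcases lt_max_iff.1 hi with h3 | h3 <;> linarith

theorem exists_flip_le (W a c : ℝ) : ∃ s, flip s W a ≤ flip s W c := by
  rcases le_total a c with h | h
  · exact ⟨true, by simpa [flip] using h⟩
  · exact ⟨false, sub_le_sub_left h W⟩

/-- A cover that beats the single enclosing square can be normalized in one of the four corners. -/
theorem TwoSquareCover.exists_corner (h : TwoSquareCover v X Y W H R R' a b c d)
    (hv : 1 < v) (hR : 2 * R < max W H) :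
    ∃ s s', CornerFeasible v (fun i => flip s W (X i)) (fun i => flip s' H (Y i)) W H R := by
  obtain ⟨s, hs⟩ := exists_flip_le W a c
  obtain ⟨s', hs'⟩ := exists_flip_le H b d
  rcases lt_or_ge (2 * R) W with hW | hW
  · rcases lt_or_ge (2 * R) H with hH | hH
    · exact ⟨s, s', ((h.flip_left s).flip_right s').corner_of_large hv hs hs' hW hH⟩
    · exact ⟨s, (h.flip_left s).exists_corner_of_wide hv hs hW hH⟩
  · have hH : 2 * R < H := (lt_max_iff.1 hR).resolve_left (by linarith)
    obtain ⟨r, hr⟩ := (h.flip_right s').swap.exists_corner_of_wide hv hs' hH hW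
    exact ⟨r, s', hr.swap⟩

end Turnpike

/-! ### The candidates of one corner -/

namespace Turnpike

/-- The data from which the candidate solutions of a corner are computed: the speed, the bounding
box `[b₁, b₂] × [d₁, d₂]` of the points using the turnpike, the largest key `κ` of the other points
and the size of the box `[0, W] × [0, H]` of all points. -/
structure Data where
  v : ℝ
  b₁ : ℝ
  b₂ : ℝ
  d₁ : ℝ
  d₂ : ℝ
  κ : ℝ
  W : ℝ
  H : ℝ

namespace Data

variable (P : Data)

/-- Radius of the square around the turnpike entrance. -/
noncomputable def ρ : ℝ := halfSide P.b₁ P.b₂ P.d₁ P.d₂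

/-- First coordinate of the facility, for radius `r`: within reach of the points on foot, and as
close as possible to the possible turnpike entrances. -/
noncomputable def facilityX (r : ℝ) : ℝ := min r (max (P.b₂ - P.ρ) (min P.κ P.W - r))

/-- Second coordinate of the facility, for radius `r`. -/
noncomputable def facilityY (r : ℝ) : ℝ := min r (max (P.d₂ - P.ρ) (min P.κ P.H - r))

/-- First coordinate of the turnpike entrance closest to the facility. -/
noncomputable def entranceX (r : ℝ) : ℝ := max (P.b₂ - P.ρ) (min (P.facilityX r) (P.b₁ + P.ρ))

/-- Second coordinate of the turnpike entrance closest to the facility. -/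
noncomputable def entranceY (r : ℝ) : ℝ := max (P.d₂ - P.ρ) (min (P.facilityY r) (P.d₁ + P.ρ))

/-- Euclidean length of the turnpike; rotated coordinates are longer by the factor `√2`. -/
noncomputable def length (r : ℝ) : ℝ :=
  Real.sqrt (((P.entranceX r - P.facilityX r) * (P.entranceX r - P.facilityX r) +
    (P.entranceY r - P.facilityY r) * (P.entranceY r - P.facilityY r)) / 2)

/-- Bound for the travel times with the facility and the turnpike for radius `r`. -/
noncomputable def value (r : ℝ) : ℝ := max r (P.ρ + P.length r / P.v)

/-- The smallest radius allowed by the conditions that do not involve the length of the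
turnpike. -/
noncomputable def base : ℝ :=
  max (max (P.κ / 2) P.ρ) (max (min P.κ P.W - (P.b₁ + P.ρ)) (min P.κ P.H - (P.d₁ + P.ρ)))

/-- The solution `r` of `√2 * v * (r - ρ) = z - r`. -/
noncomputable def linearRoot (z : ℝ) : ℝ := (z + √2 * P.v * P.ρ) / (1 + √2 * P.v)

/-- The larger solution `r` of `2 * (v * (r - ρ)) ^ 2 = (b₂ - ρ - r) ^ 2 + (d₂ - ρ - r) ^ 2`, by the
quadratic formula for `r - ρ`. -/
noncomputable def quadraticRoot : ℝ :=
  P.ρ + (Real.sqrt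
      (((P.b₂ - P.ρ - P.ρ) + (P.d₂ - P.ρ - P.ρ)) * ((P.b₂ - P.ρ - P.ρ) + (P.d₂ - P.ρ - P.ρ)) +
        (2 * P.v * P.v - 2) * ((P.b₂ - P.ρ - P.ρ) * (P.b₂ - P.ρ - P.ρ) +
          (P.d₂ - P.ρ - P.ρ) * (P.d₂ - P.ρ - P.ρ))) -
    ((P.b₂ - P.ρ - P.ρ) + (P.d₂ - P.ρ - P.ρ))) / (2 * P.v * P.v - 2)

/-- The four candidates for the radius. -/
noncomputable def candidate (k : Fin 4) : ℝ :=
  max P.base (![P.base, P.linearRoot (P.b₂ - P.ρ), P.linearRoot (P.d₂ - P.ρ),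
    P.quadraticRoot] k)

/-- The difference of the two sides of `Feasible.dist`. For `r ≥ ρ` it is nonnegative if and only if
the turnpike is short enough. -/
noncomputable def slack (r : ℝ) : ℝ :=
  2 * (P.v * (r - P.ρ)) ^ 2 - (max 0 (P.b₂ - P.ρ - r) ^ 2 + max 0 (P.d₂ - P.ρ - r) ^ 2)

theorem base_le_candidate (k : Fin 4) : P.base ≤ P.candidate k := le_max_left _ _

variable {P}

theorem base_le_iff {r : ℝ} : P.base ≤ r ↔ (P.κ / 2 ≤ r ∧ P.ρ ≤ r) ∧
    (min P.κ P.W - (P.b₁ + P.ρ) ≤ r ∧ min P.κ P.H - (P.d₁ + P.ρ) ≤ r) := by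
  simp only [base, max_le_iff]

/-- In one coordinate: `f` is the facility and `[p, p']` the range of the entrances. -/
theorem entrance_sub_facility {p p' k r : ℝ} (hp : p ≤ p') (h1 : k - p' ≤ r) (h2 : k ≤ 2 * r) :
    (max p (min (min r (max p (k - r))) p') - min r (max p (k - r))) ^ 2 ≤ max 0 (p - r) ^ 2 := by
  rcases le_total r p with h | h
  · have hf : min r (max p (k - r)) = r := min_eq_left (h.trans (le_max_left _ _))
    rw [hf, min_eq_left (h.trans hp), max_eq_left h, max_eq_right (sub_nonneg.2 h)]
  · have hf : min r (max p (k - r)) = max p (k - r) := min_eq_right (max_le h (by linarith))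
    rw [hf, min_eq_left (max_le hp (by linarith)), max_eq_right (le_max_left _ _), sub_self]
    simp

theorem value_le {r : ℝ} (hv : 0 < P.v) (hb : P.base ≤ r) (hs : 0 ≤ P.slack r) :
    P.value r ≤ r := by
  obtain ⟨⟨h1, h2⟩, h3, h4⟩ := base_le_iff.1 hb
  have hpq := sub_halfSide_le P.b₁ P.b₂ P.d₁ P.d₂
  have hx : (P.entranceX r - P.facilityX r) ^ 2 ≤ max 0 (P.b₂ - P.ρ - r) ^ 2 :=
    entrance_sub_facility hpq.1 (by linarith) (by linarith [min_le_left P.κ P.W])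
  have hy : (P.entranceY r - P.facilityY r) ^ 2 ≤ max 0 (P.d₂ - P.ρ - r) ^ 2 :=
    entrance_sub_facility hpq.2 (by linarith) (by linarith [min_le_left P.κ P.H])
  have hl : P.length r ≤ P.v * (r - P.ρ) := by
    refine Real.sqrt_le_iff.2 ⟨mul_nonneg hv.le (by linarith), ?_⟩
    unfold slack at hs
    linarith
  refine max_le le_rfl ?_
  have : P.length r / P.v ≤ r - P.ρ := by
    rw [div_le_iff₀ hv]
    linarith
  linarith

theorem continuous_slack : Continuous P.slack := by
  unfold slack
  fun_prop

theorem eq_linearRoot {z r : ℝ} (hv : 0 < P.v) (hr : P.ρ ≤ r) (hz : r ≤ z)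
    (h : 2 * (P.v * (r - P.ρ)) ^ 2 = (z - r) ^ 2) : r = P.linearRoot z := by
  have h2 : √2 * √2 = (2 : ℝ) := Real.mul_self_sqrt (by norm_num)
  have h3 : √2 * P.v * (r - P.ρ) = z - r := by
    have h4 : 0 ≤ √2 * P.v * (r - P.ρ) := mul_nonneg (by positivity) (by linarith)
    refine (pow_left_inj₀ h4 (by linarith) two_ne_zero).1 ?_
    rw [← h, mul_assoc, mul_pow, pow_two (√2), h2]
  rw [linearRoot, eq_div_iff (by positivity)]
  linarith

theorem eq_quadraticRoot {r : ℝ} (hv : 1 < P.v) (hr : P.ρ ≤ r) (hp : r ≤ P.b₂ - P.ρ)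
    (hq : r ≤ P.d₂ - P.ρ)
    (h : 2 * (P.v * (r - P.ρ)) ^ 2 = (P.b₂ - P.ρ - r) ^ 2 + (P.d₂ - P.ρ - r) ^ 2) :
    r = P.quadraticRoot := by
  have ha : 0 < 2 * P.v * P.v - 2 := by nlinarith
  unfold quadraticRoot
  have e1 : P.b₂ - P.ρ - r = (P.b₂ - P.ρ - P.ρ) - (r - P.ρ) := by ring
  have e2 : P.d₂ - P.ρ - r = (P.d₂ - P.ρ - P.ρ) - (r - P.ρ) := by ring
  rw [e1, e2] at h
  have hp' : r - P.ρ ≤ P.b₂ - P.ρ - P.ρ := by linarith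
  have hq' : r - P.ρ ≤ P.d₂ - P.ρ - P.ρ := by linarith
  rw [← sub_eq_iff_eq_add', eq_div_iff ha.ne', eq_sub_iff_add_eq, eq_comm]
  generalize P.b₂ - P.ρ - P.ρ = p at *
  generalize P.d₂ - P.ρ - P.ρ = q at *
  have hz : 0 ≤ r - P.ρ := by linarith
  generalize r - P.ρ = z at *
  have h0 : 0 ≤ z * (2 * P.v * P.v - 2) := mul_nonneg hz ha.le
  refine (Real.sqrt_eq_iff_eq_sq ?_ (by linarith)).2 ?_
  · have : 0 ≤ (2 * P.v * P.v - 2) * (p * p + q * q) :=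
      mul_nonneg ha.le (add_nonneg (mul_self_nonneg _) (mul_self_nonneg _))
    nlinarith [mul_self_nonneg (p + q)]
  · linear_combination -(2 * P.v * P.v - 2) * h

/-- Every radius that is large enough is at least the value of a candidate. As the slack is
continuous, either it is nonnegative at the smallest possible radius, or it has a zero. -/
theorem exists_candidate {R : ℝ} (hv : 1 < P.v) (hb : P.base ≤ R) (hs : 0 ≤ P.slack R) :
    ∃ k, P.value (P.candidate k) ≤ R := by
  have hv0 : 0 < P.v := by linarith
  suffices h : ∃ k, P.candidate k ≤ R ∧ 0 ≤ P.slack (P.candidate k) by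
    obtain ⟨k, hk, hk'⟩ := h
    exact ⟨k, (value_le hv0 (P.base_le_candidate k) hk').trans hk⟩
  by_cases h0 : 0 ≤ P.slack P.base
  · exact ⟨0, by simpa [candidate] using hb, by simpa [candidate] using h0⟩
  · obtain ⟨r, ⟨hbr, hrR⟩, hr⟩ := intermediate_value_Icc hb continuous_slack.continuousOn
      (show (0 : ℝ) ∈ Set.Icc (P.slack P.base) (P.slack R) from ⟨(not_le.1 h0).le, hs⟩)
    suffices h : ∃ k, P.candidate k = r by
      obtain ⟨k, rfl⟩ := h
      exact ⟨k, hrR, hr.ge⟩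
    have hρr : P.ρ < r := by
      refine lt_of_le_of_lt (base_le_iff.1 le_rfl).1.2 (lt_of_le_of_ne hbr fun h => ?_)
      rw [h] at h0
      exact h0 hr.ge
    have hpos : 0 < P.v * (r - P.ρ) := mul_pos hv0 (by linarith)
    unfold slack at hr
    rcases le_total (P.b₂ - P.ρ) r with hp | hp <;> rcases le_total (P.d₂ - P.ρ) r with hq | hq
    · rw [max_eq_left (sub_nonpos.2 hp), max_eq_left (sub_nonpos.2 hq)] at hr
      nlinarith
    · rw [max_eq_left (sub_nonpos.2 hp), max_eq_right (sub_nonneg.2 hq)] at hr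
      have := eq_linearRoot hv0 hρr.le hq (by linarith)
      exact ⟨2, by simpa [candidate, ← this] using hbr⟩
    · rw [max_eq_right (sub_nonneg.2 hp), max_eq_left (sub_nonpos.2 hq)] at hr
      have := eq_linearRoot hv0 hρr.le hp (by linarith)
      exact ⟨1, by simpa [candidate, ← this] using hbr⟩
    · rw [max_eq_right (sub_nonneg.2 hp), max_eq_right (sub_nonneg.2 hq)] at hr
      have := eq_quadraticRoot hv hρr.le hp hq (by linarith)
      exact ⟨3, by simpa [candidate, ← this] using hbr⟩

theorem exists_candidate_of_feasible {R : ℝ} (hv : 1 < P.v) (hκ : P.κ ≤ 2 * R)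
    (h : Feasible P.v P.W P.H R P.b₁ P.b₂ P.d₁ P.d₂) : ∃ k, P.value (P.candidate k) ≤ R := by
  refine exists_candidate hv (base_le_iff.2 ⟨⟨by linarith, h.halfSide_le⟩, ?_, ?_⟩)
    (sub_nonneg.2 h.dist)
  · have := h.width
    have := min_le_min_right P.W hκ
    unfold ρ
    linarith
  · have := h.height
    have := min_le_min_right P.H hκ
    unfold ρ
    linarith

/-- A point that walks, in one coordinate. -/
theorem abs_sub_facility_le {p k r x : ℝ} (h0 : 0 ≤ x) (hx : x ≤ k) (hk : k ≤ 2 * r) :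
    |x - min r (max p (k - r))| ≤ r := by
  have h1 := min_le_left r (max p (k - r))
  have h2 : k - r ≤ min r (max p (k - r)) := le_min (by linarith) (le_max_right _ _)
  rw [abs_le]
  constructor <;> linarith

/-- A point that uses the turnpike, in one coordinate. -/
theorem abs_sub_entrance_le {b b' ρ f x : ℝ} (h : b' - ρ ≤ b + ρ) (h1 : b ≤ x) (h2 : x ≤ b') :
    |x - max (b' - ρ) (min f (b + ρ))| ≤ ρ := by
  have h3 := le_max_left (b' - ρ) (min f (b + ρ))
  have h4 := max_le h (min_le_right f (b + ρ))
  rw [abs_le]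
  constructor <;> linarith

/-- The value of a candidate is a bound for the travel times, in rotated coordinates. -/
theorem time_le_value {r x y : ℝ} (hb : P.base ≤ r) (hx : 0 ≤ x ∧ x ≤ P.W) (hy : 0 ≤ y ∧ y ≤ P.H)
    (h : max x y ≤ P.κ ∨ ((P.b₁ ≤ x ∧ x ≤ P.b₂) ∧ (P.d₁ ≤ y ∧ y ≤ P.d₂))) :
    min (max |x - P.facilityX r| |y - P.facilityY r|)
      (max |x - P.entranceX r| |y - P.entranceY r| + P.length r / P.v) ≤ P.value r := by
  obtain ⟨⟨h1, -⟩, -, -⟩ := base_le_iff.1 hb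
  rcases h with h | ⟨hbx, hby⟩
  · obtain ⟨h2, h3⟩ := max_le_iff.1 h
    refine (min_le_left _ _).trans ((max_le ?_ ?_).trans (le_max_left _ _))
    · exact abs_sub_facility_le hx.1 (le_min h2 hx.2) (by linarith [min_le_left P.κ P.W])
    · exact abs_sub_facility_le hy.1 (le_min h3 hy.2) (by linarith [min_le_left P.κ P.H])
  · have hpq := sub_halfSide_le P.b₁ P.b₂ P.d₁ P.d₂
    refine (min_le_right _ _).trans (le_trans ?_ (le_max_right _ _))
    refine add_le_add_left (max_le ?_ ?_) _
    · exact abs_sub_entrance_le hpq.1 hbx.1 hbx.2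
    · exact abs_sub_entrance_le hpq.2 hby.1 hby.2

end Data

end Turnpike

/-! ### The program -/

namespace RealRAM

open Turnpike

theorem Runs.loop {M : ℕ} {b : Test} {c : Cmd} (I : State → Prop) (μ : State → ℕ)
    (hstep : ∀ s, I s → b.Holds s → wp M c (fun s' => I s' ∧ μ s' < μ s) s)
    {N : ℕ} {s : State} (hI : I s) (hμ : μ s ≤ N) :
    Runs M (.while b c) s ((b.cost + 1 + c.worst) * (N + 1)) fun s' => I s' ∧ ¬ b.Holds s' := by
  refine (Runs.while_loop I μ (fun s hI hb => (hstep s hI hb).runs) N s hI hμ).mono ?_ fun _ h => h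
  rw [mul_add_one, mul_comm N]
  omega

/-- Coordinate `z` of the interval `[lo, hi]`, measured from its left or from its right end. -/
def coord (a : Bool) (lo hi z : ℝ) : ℝ := if a then z - lo else hi - z

/-- Inverse of `coord`. -/
def uncoord (a : Bool) (lo hi x : ℝ) : ℝ := if a then lo + x else hi - x

theorem coord_eq_flip (a : Bool) (lo hi z : ℝ) :
    coord a lo hi z = Turnpike.flip a (hi - lo) (z - lo) := by
  cases a <;> simp [coord, Turnpike.flip]

theorem abs_coord_sub (a : Bool) (lo hi z x : ℝ) :
    |coord a lo hi z - x| = |z - uncoord a lo hi x| := by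
  cases a
  · simp only [coord, uncoord, Bool.false_eq_true, if_false]
    rw [abs_sub_comm]
    congr 1
    ring
  · simp only [coord, uncoord, if_true]
    congr 1
    ring

theorem sq_uncoord_sub (a : Bool) (lo hi x y : ℝ) :
    (uncoord a lo hi x - uncoord a lo hi y) ^ 2 = (x - y) * (x - y) := by
  cases a <;> simp only [uncoord, Bool.false_eq_true, if_false, if_true] <;> ring

/-- The first rotated coordinate of the point held by the registers `17` and `18`, measured from the
left or the right side of the rotated bounding box `[r₈, r₉] × [r₁₀, r₁₁]`. -/
def xE (a : Bool) : RExp :=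
  if a then .reg 17 + .reg 18 - .reg 8 else .reg 9 - (.reg 17 + .reg 18)

/-- The second rotated coordinate of this point, measured from the lower or the upper side. -/
def yE (b : Bool) : RExp :=
  if b then .reg 17 - .reg 18 - .reg 10 else .reg 11 - (.reg 17 - .reg 18)

@[simp] theorem eval_xE (a : Bool) (s : State) :
    (xE a).eval s = coord a (s.rreg 8) (s.rreg 9) (s.rreg 17 + s.rreg 18) := by
  cases a <;> simp [xE, coord]

@[simp] theorem eval_yE (b : Bool) (s : State) :
    (yE b).eval s = coord b (s.rreg 10) (s.rreg 11) (s.rreg 17 - s.rreg 18) := by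
  cases b <;> simp [yE, coord]

/-- The registers from which candidate solutions are computed. -/
def State.data (s : State) : Data :=
  ⟨s.rreg 6, s.rreg 12, s.rreg 13, s.rreg 14, s.rreg 15, s.rreg 16, s.rreg 9 - s.rreg 8,
    s.rreg 11 - s.rreg 10⟩

/-- The other registers do not matter for the candidates. -/
@[simp] theorem data_update {k : ℕ} (hk : k < 6 ∨ k = 7 ∨ k = 19) (z : ℝ) (r : ℕ → ℝ) (i : ℕ → ℕ)
    (m : ℕ → ℝ) (m' : ℕ → ℕ) :
    State.data ⟨Function.update r k z, i, m, m'⟩ = State.data ⟨r, i, m, m'⟩ := by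
  have : ∀ j, 6 ≤ j → j ≠ 7 → j ≠ 19 → Function.update r k z j = r j :=
    fun j h1 h2 h3 => Function.update_of_ne (by omega) _ _
  simp [State.data, this]

/-! The following expressions compute the quantities of `Data` from the registers. The radius `r` is
read from register `19`. -/

def rhoE : RExp := max (.reg 13 - .reg 12) (.reg 15 - .reg 14) / .const 2
def kxE : RExp := min (.reg 16) (.reg 9 - .reg 8)
def kyE : RExp := min (.reg 16) (.reg 11 - .reg 10)
def facilityXE : RExp := min (.reg 19) (max (.reg 13 - rhoE) (kxE - .reg 19))
def facilityYE : RExp := min (.reg 19) (max (.reg 15 - rhoE) (kyE - .reg 19))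
def entranceXE : RExp := max (.reg 13 - rhoE) (min facilityXE (.reg 12 + rhoE))
def entranceYE : RExp := max (.reg 15 - rhoE) (min facilityYE (.reg 14 + rhoE))
def lengthE : RExp :=
  .sqrt (((entranceXE - facilityXE) * (entranceXE - facilityXE) +
    (entranceYE - facilityYE) * (entranceYE - facilityYE)) / .const 2)
def valueE : RExp := max (.reg 19) (rhoE + lengthE / .reg 6)
def baseE : RExp :=
  max (max (.reg 16 / .const 2) rhoE) (max (kxE - (.reg 12 + rhoE)) (kyE - (.reg 14 + rhoE)))
def linearRootE (z : RExp) : RExp :=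
  (z + .sqrt (.const 2) * .reg 6 * rhoE) / (.const 1 + .sqrt (.const 2) * .reg 6)
def quadraticRootE : RExp :=
  rhoE + (.sqrt
      (((.reg 13 - rhoE - rhoE) + (.reg 15 - rhoE - rhoE)) *
          ((.reg 13 - rhoE - rhoE) + (.reg 15 - rhoE - rhoE)) +
        (.const 2 * .reg 6 * .reg 6 - .const 2) * ((.reg 13 - rhoE - rhoE) * (.reg 13 - rhoE - rhoE)
          + (.reg 15 - rhoE - rhoE) * (.reg 15 - rhoE - rhoE))) -
    ((.reg 13 - rhoE - rhoE) + (.reg 15 - rhoE - rhoE))) / (.const 2 * .reg 6 * .reg 6 - .const 2)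
def candidateE (k : Fin 4) : RExp :=
  max baseE (![baseE, linearRootE (.reg 13 - rhoE), linearRootE (.reg 15 - rhoE),
    quadraticRootE] k)

section eval

variable (s : State)

@[simp] theorem eval_rhoE : rhoE.eval s = s.data.ρ := by
  simp [rhoE, Data.ρ, halfSide, State.data]

@[simp] theorem eval_facilityXE : facilityXE.eval s = s.data.facilityX (s.rreg 19) := by
  simp [facilityXE, kxE, Data.facilityX, State.data]

@[simp] theorem eval_facilityYE : facilityYE.eval s = s.data.facilityY (s.rreg 19) := by
  simp [facilityYE, kyE, Data.facilityY, State.data]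

@[simp] theorem eval_entranceXE : entranceXE.eval s = s.data.entranceX (s.rreg 19) := by
  simp [entranceXE, Data.entranceX, State.data]

@[simp] theorem eval_entranceYE : entranceYE.eval s = s.data.entranceY (s.rreg 19) := by
  simp [entranceYE, Data.entranceY, State.data]

@[simp] theorem eval_valueE : valueE.eval s = s.data.value (s.rreg 19) := by
  simp [valueE, lengthE, Data.value, Data.length]
  rfl

theorem eval_baseE : baseE.eval s = s.data.base := by
  simp [baseE, kxE, kyE, Data.base]
  rfl

theorem eval_linearRootE (z : RExp) : (linearRootE z).eval s = s.data.linearRoot (z.eval s) := by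
  simp [linearRootE, Data.linearRoot]
  rfl

theorem eval_quadraticRootE : quadraticRootE.eval s = s.data.quadraticRoot := by
  simp [quadraticRootE, Data.quadraticRoot]
  rfl

@[simp] theorem eval_candidateE (k : Fin 4) : (candidateE k).eval s = s.data.candidate k := by
  fin_cases k <;>
    simp [candidateE, Data.candidate, eval_baseE, eval_linearRootE, eval_quadraticRootE] <;> rfl

end eval

/-- The first coordinate in the plane of the point with coordinates `x` and `y` with respect to the
corner `(a, b)` of the rotated bounding box. -/
def outXE (a b : Bool) (x y : RExp) : RExp :=
  ((if a then .reg 8 + x else .reg 9 - x) + (if b then .reg 10 + y else .reg 11 - y)) / .const 2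

/-- The second coordinate in the plane of this point. -/
def outYE (a b : Bool) (x y : RExp) : RExp :=
  ((if a then .reg 8 + x else .reg 9 - x) - (if b then .reg 10 + y else .reg 11 - y)) / .const 2

@[simp] theorem eval_outXE (a b : Bool) (x y : RExp) (s : State) :
    (outXE a b x y).eval s = (uncoord a (s.rreg 8) (s.rreg 9) (x.eval s) +
      uncoord b (s.rreg 10) (s.rreg 11) (y.eval s)) / 2 := by
  cases a <;> cases b <;> simp [outXE, uncoord]

@[simp] theorem eval_outYE (a b : Bool) (x y : RExp) (s : State) :
    (outYE a b x y).eval s = (uncoord a (s.rreg 8) (s.rreg 9) (x.eval s) -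
      uncoord b (s.rreg 10) (s.rreg 11) (y.eval s)) / 2 := by
  cases a <;> cases b <;> simp [outYE, uncoord]

/-- Stores the solution for the radius in register `19` as the best one if it is an improvement.
The register `7` holds the value of the best solution. -/
def considerCmd (a b : Bool) : Cmd :=
  .ite (.rle valueE (.reg 7))
    (.block [.rset 7 valueE,
      .rset 0 (outXE a b facilityXE facilityYE), .rset 1 (outYE a b facilityXE facilityYE),
      .rset 2 (outXE a b entranceXE entranceYE), .rset 3 (outYE a b entranceXE entranceYE),
      .rset 4 (.reg 0), .rset 5 (.reg 1)])
    .skip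

/-- Tries all candidates for the current turnpike users. -/
def candidatesCmd (a b : Bool) : Cmd :=
  .block [.rset 19 (candidateE 0), considerCmd a b, .rset 19 (candidateE 1), considerCmd a b,
    .rset 19 (candidateE 2), considerCmd a b, .rset 19 (candidateE 3), considerCmd a b]

/-- Node `i` of the tournament tree is the memory cell `2 * n + i`. -/
def nodeE (i : IExp) : IExp := .reg 0 + .reg 0 + i

@[simp] theorem eval_nodeE (i : IExp) (s : State) :
    (nodeE i).eval s = s.ireg 0 + s.ireg 0 + i.eval s := rfl

/-- Loads the two children of the node `r₂`. -/
def loadChildren : Cmd :=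
  .block [.rload 17 (nodeE (.reg 2 + .reg 2)), .rload 18 (nodeE (.reg 2 + .reg 2 + .const 1))]

/-- Writes the keys of the points into the leaves `n, …, 2 * n - 1`. The key of a point is the
larger one of its coordinates with respect to the corner. -/
def fillBody (a b : Bool) : Cmd :=
  .block [.rload 17 (.reg 1 + .reg 1), .rload 18 (.reg 1 + .reg 1 + .const 1),
    .rstore (nodeE (.reg 0 + .reg 1)) (max (xE a) (yE b)), .iset 1 (.reg 1 + .const 1)]

def fillLoop (a b : Bool) : Cmd := .while (.ile (.reg 1 + .const 1) (.reg 0)) (fillBody a b)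

/-- Fills the inner node `r₂`, and the parent table at its children. -/
def buildBody : Cmd :=
  .block [loadChildren, .rstore (nodeE (.reg 2)) (max (.reg 17) (.reg 18)),
    .istore (.reg 2 + .reg 2) (.reg 2), .istore (.reg 2 + .reg 2 + .const 1) (.reg 2),
    .iset 2 (.reg 2 - .const 1)]

def buildLoop : Cmd := .while (.ile (.const 1) (.reg 2)) buildBody

/-- The loop that walks from the root to a leaf with the same key. -/
def descendBody : Cmd :=
  .block [loadChildren, .ite (.rle (.reg 18) (.reg 17)) (.iset 2 (.reg 2 + .reg 2))
    (.iset 2 (.reg 2 + .reg 2 + .const 1))]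

def descendLoop : Cmd := .while (.ile (.reg 2 + .const 1) (.reg 0)) descendBody

/-- Adds the point of the leaf `r₂` to the bounding box of the turnpike users and removes it from
the tree. -/
def removeCmd (a b : Bool) : Cmd :=
  .block [.rload 17 (.reg 2 + .reg 2 - (.reg 0 + .reg 0)),
    .rload 18 (.reg 2 + .reg 2 - (.reg 0 + .reg 0) + .const 1),
    .rset 12 (min (.reg 12) (xE a)), .rset 13 (max (.reg 13) (xE a)),
    .rset 14 (min (.reg 14) (yE b)), .rset 15 (max (.reg 15) (yE b)),
    .rstore (nodeE (.reg 2)) (.const (-1))]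

/-- The loop that repairs the tree on the way to the root. -/
def ascendBody : Cmd :=
  .block [.iload 2 (.reg 2), loadChildren, .rstore (nodeE (.reg 2)) (max (.reg 17) (.reg 18))]

def ascendLoop : Cmd := .while (.ile (.const 2) (.reg 2)) ascendBody

/-- Loads the largest key of a walking point. -/
def loadRoot : Cmd := .rload 16 (nodeE (.const 1))

/-- Makes a point with the largest key a turnpike user, and tries the resulting candidates. -/
def mainBody (a b : Bool) : Cmd :=
  .seq (.iset 2 (.const 1)) (.seq descendLoop (.seq (removeCmd a b) (.seq ascendLoop
    (.seq loadRoot (candidatesCmd a b)))))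

/-- The loop runs until the root is `-1`, that is, until no point walks. -/
def mainLoop (a b : Bool) : Cmd := .while (.rle (.const 0) (.reg 16)) (mainBody a b)

/-- Starts the bounding box of the turnpike users with the inverted box that `IsBox` prescribes for
the empty set. -/
def initBox : Cmd :=
  .block [.rset 12 (.reg 9 - .reg 8), .rset 13 (.const 0), .rset 14 (.reg 11 - .reg 10),
    .rset 15 (.const 0), loadRoot]

/-- Finds the best solution with the facility at the corner `(a, b)`. -/
def cornerCmd (a b : Bool) : Cmd :=
  .seq (.iset 1 (.const 0)) (.seq (fillLoop a b) (.seq (.iset 2 (.reg 0 - .const 1))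
    (.seq buildLoop (.seq initBox (mainLoop a b)))))

/-- Starts the rotated bounding box with the first point. -/
def hullInit : Cmd :=
  .block [.rset 6 (.reg 0), .rload 17 (.const 0), .rload 18 (.const 1),
    .rset 8 (.reg 17 + .reg 18), .rset 9 (.reg 17 + .reg 18),
    .rset 10 (.reg 17 - .reg 18), .rset 11 (.reg 17 - .reg 18)]

/-- Extends the rotated bounding box by the point `r₁`. -/
def hullBody : Cmd :=
  .block [.rload 17 (.reg 1 + .reg 1), .rload 18 (.reg 1 + .reg 1 + .const 1),
    .rset 8 (min (.reg 8) (.reg 17 + .reg 18)), .rset 9 (max (.reg 9) (.reg 17 + .reg 18)),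
    .rset 10 (min (.reg 10) (.reg 17 - .reg 18)), .rset 11 (max (.reg 11) (.reg 17 - .reg 18)),
    .iset 1 (.reg 1 + .const 1)]

def hullLoop : Cmd := .while (.ile (.reg 1 + .const 1) (.reg 0)) hullBody

/-- The solution without a turnpike: the facility is the center of the rotated bounding box. -/
def walkCmd : Cmd :=
  .block [.rset 7 (max (.reg 9 - .reg 8) (.reg 11 - .reg 10) / .const 2),
    .rset 0 ((.reg 8 + .reg 9 + (.reg 10 + .reg 11)) / .const 4),
    .rset 1 ((.reg 8 + .reg 9 - (.reg 10 + .reg 11)) / .const 4),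
    .rset 2 (.reg 0), .rset 3 (.reg 1), .rset 4 (.reg 0), .rset 5 (.reg 1)]

/-- The whole program. Its real registers are
* `0, …, 5`: the best solution so far, `7`: its value;
* `6`: the speed;
* `8, …, 11`: the rotated bounding box of all points;
* `12, …, 15`: the bounding box of the turnpike users with respect to the current corner;
* `16`: the root of the tournament tree, `17`, `18`: loaded points or nodes, `19`: a radius.

The index registers are `0`: the number of points, `1`: a point, `2`: a node of the tree. -/
def program : Cmd :=
  .seq hullInit (.seq hullLoop (.seq walkCmd (.seq (cornerCmd true true)
    (.seq (cornerCmd true false) (.seq (cornerCmd false true) (cornerCmd false false))))))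

/-! ### Candidates -/

/-- The best solution so far, in the registers `0, …, 5`, has at most the value in register `7`. -/
def Good {n : ℕ} (v : ℝ) (S : Fin n → ℝ × ℝ) (s : State) : Prop :=
  ∀ i, travelTime v (s.point 0) (s.point 1) (s.point 2) (S i) ≤ s.rreg 7

/-- Only the registers `0, …, 5`, `7` and `19` have changed. -/
structure SameInput (s s' : State) : Prop where
  ireg : s'.ireg = s.ireg
  rmem : s'.rmem = s.rmem
  imem : s'.imem = s.imem
  rreg : ∀ k, 6 ≤ k → k ≠ 7 → k ≠ 19 → s'.rreg k = s.rreg k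

theorem SameInput.refl (s : State) : SameInput s s := ⟨rfl, rfl, rfl, fun _ _ _ _ => rfl⟩

theorem SameInput.trans {s s' s'' : State} (h : SameInput s s') (h' : SameInput s' s'') :
    SameInput s s'' :=
  ⟨h'.ireg.trans h.ireg, h'.rmem.trans h.rmem, h'.imem.trans h.imem,
    fun k h1 h2 h3 => (h'.rreg k h1 h2 h3).trans (h.rreg k h1 h2 h3)⟩

theorem SameInput.data {s s' : State} (h : SameInput s s') : s'.data = s.data := by
  simp [State.data, h.rreg]

/-- The assumption under which the candidates are valid: each point is a walker, with a key of at
most `κ`, or a turnpike user, in the box. -/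
structure Served {n : ℕ} (S : Fin n → ℝ × ℝ) (a b : Bool) (s : State) : Prop where
  x : ∀ i, 0 ≤ coord a (s.rreg 8) (s.rreg 9) ((S i).1 + (S i).2) ∧
    coord a (s.rreg 8) (s.rreg 9) ((S i).1 + (S i).2) ≤ s.rreg 9 - s.rreg 8
  y : ∀ i, 0 ≤ coord b (s.rreg 10) (s.rreg 11) ((S i).1 - (S i).2) ∧
    coord b (s.rreg 10) (s.rreg 11) ((S i).1 - (S i).2) ≤ s.rreg 11 - s.rreg 10
  served : ∀ i, max (coord a (s.rreg 8) (s.rreg 9) ((S i).1 + (S i).2))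
      (coord b (s.rreg 10) (s.rreg 11) ((S i).1 - (S i).2)) ≤ s.rreg 16 ∨
    ((s.rreg 12 ≤ coord a (s.rreg 8) (s.rreg 9) ((S i).1 + (S i).2) ∧
      coord a (s.rreg 8) (s.rreg 9) ((S i).1 + (S i).2) ≤ s.rreg 13) ∧
    (s.rreg 14 ≤ coord b (s.rreg 10) (s.rreg 11) ((S i).1 - (S i).2) ∧
      coord b (s.rreg 10) (s.rreg 11) ((S i).1 - (S i).2) ≤ s.rreg 15))

theorem Served.congr {n : ℕ} {S : Fin n → ℝ × ℝ} {a b : Bool} {s s' : State}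
    (h : Served S a b s) (h' : SameInput s s') : Served S a b s' := by
  obtain ⟨h1, h2, h3⟩ := h
  constructor <;> simpa only [h'.rreg, Nat.reduceLeDiff, ne_eq, Nat.reduceEqDiff, not_false_eq_true]

/-- Travel times in terms of coordinates with respect to a corner. -/
theorem travelTime_le_coord {v : ℝ} {f t p : ℝ × ℝ} {a b : Bool} {lo hi lo' hi' fx fy tx ty : ℝ}
    (hf : f.1 + f.2 = uncoord a lo hi fx) (hf' : f.1 - f.2 = uncoord b lo' hi' fy)
    (ht : t.1 + t.2 = uncoord a lo hi tx) (ht' : t.1 - t.2 = uncoord b lo' hi' ty) :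
    travelTime v f t f p ≤
      min (max |coord a lo hi (p.1 + p.2) - fx| |coord b lo' hi' (p.1 - p.2) - fy|)
        (max |coord a lo hi (p.1 + p.2) - tx| |coord b lo' hi' (p.1 - p.2) - ty| +
          Real.sqrt (((tx - fx) * (tx - fx) + (ty - fy) * (ty - fy)) / 2) / v) := by
  have h : l1Dist f f = 0 := by simp [l1Dist]
  rw [← sq_uncoord_sub a lo hi, ← sq_uncoord_sub b lo' hi']
  simp only [abs_coord_sub, ← hf, ← hf', ← ht, ← ht', ← l1Dist_eq_max]
  rw [← l2Dist_eq_sqrt]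
  rw [travelTime, h, add_zero]
  exact le_min (min_le_left _ _) ((min_le_right _ _).trans (min_le_left _ _))

theorem consider_spec {n M : ℕ} {S : Fin n → ℝ × ℝ} {a b : Bool} {s : State}
    (hS : Served S a b s) (hg : Good (s.rreg 6) S s) (hr : s.data.base ≤ s.rreg 19) :
    wp M (considerCmd a b) (fun s' => SameInput s s' ∧ Good (s.rreg 6) S s' ∧
      s'.rreg 7 ≤ s.rreg 7 ∧ s'.rreg 7 ≤ s.data.value (s.rreg 19)) s := by
  refine ⟨fun hlt => ?_, fun hlt => ⟨SameInput.refl s, hg, le_rfl, ?_⟩⟩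
  · simp only [Test.Holds, eval_valueE, RExp.eval_reg] at hlt
    simp [wp]
    refine ⟨⟨rfl, rfl, rfl, fun k h1 h2 h3 => ?_⟩, fun i => ?_, hlt⟩
    · simp only [Function.update_apply]
      simp only [if_neg (show k ≠ 0 by omega), if_neg (show k ≠ 1 by omega),
        if_neg (show k ≠ 2 by omega), if_neg (show k ≠ 3 by omega), if_neg (show k ≠ 4 by omega),
        if_neg (show k ≠ 5 by omega), if_neg h2]
    · refine le_trans ?_ (Data.time_le_value hr (hS.x i) (hS.y i) (hS.served i))
      have heta : State.mk s.rreg s.ireg s.rmem s.imem = s := rfl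
      simp [State.point, heta, -le_inf_iff, -le_sup_iff]
      refine travelTime_le_coord ?_ ?_ ?_ ?_ <;> ring
  · simp only [Test.Holds, eval_valueE, RExp.eval_reg, not_le] at hlt
    exact hlt.le

theorem candidates_spec {n M : ℕ} {S : Fin n → ℝ × ℝ} {a b : Bool} {s : State}
    (hS : Served S a b s) (hg : Good (s.rreg 6) S s) :
    wp M (candidatesCmd a b) (fun s' => SameInput s s' ∧ Good (s.rreg 6) S s' ∧
      s'.rreg 7 ≤ s.rreg 7 ∧ ∀ k, s'.rreg 7 ≤ s.data.value (s.data.candidate k)) s := by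
  -- one candidate, after some others
  have step : ∀ (k : Fin 4) (s₁ : State) (Q : State → Prop), SameInput s s₁ →
      Good (s.rreg 6) S s₁ → (∀ s₂, SameInput s s₂ → Good (s.rreg 6) S s₂ →
        s₂.rreg 7 ≤ s₁.rreg 7 → s₂.rreg 7 ≤ s.data.value (s.data.candidate k) → Q s₂) →
      wp M (.rset 19 (candidateE k)) (wp M (considerCmd a b) Q) s₁ := by
    intro k s₁ Q h hg' hQ
    simp only [wp, eval_candidateE]
    have h' : SameInput s
        { s₁ with rreg := Function.update s₁.rreg 19 (s₁.data.candidate k) } :=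
      h.trans ⟨rfl, rfl, rfl, fun k _ _ h3 => Function.update_of_ne h3 _ _⟩
    have h6 := h'.rreg 6 (by simp) (by simp) (by simp)
    refine wp.mono (consider_spec (hS.congr h') ?_ ?_) ?_
    · rw [h6]
      intro i
      simpa [State.point, Function.update_apply] using hg' i
    · rw [h'.data]
      simpa [h.data] using s.data.base_le_candidate k
    · rintro s₂ ⟨hs, hg₂, hle, hval⟩
      rw [h6] at hg₂
      refine hQ s₂ (h'.trans hs) hg₂ (by simpa [Function.update_apply] using hle) ?_
      rw [h'.data] at hval
      simpa [h.data] using hval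
  rw [candidatesCmd]
  simp only [wp_block_cons]
  refine step 0 s _ (.refl s) hg fun s₁ h₁ g₁ l₁ v₁ => ?_
  refine step 1 s₁ _ h₁ g₁ fun s₂ h₂ g₂ l₂ v₂ => ?_
  refine step 2 s₂ _ h₂ g₂ fun s₃ h₃ g₃ l₃ v₃ => ?_
  refine step 3 s₃ _ h₃ g₃ fun s₄ h₄ g₄ l₄ v₄ => ⟨h₄, g₄, by linarith, fun k => ?_⟩
  fin_cases k
  · exact (l₄.trans (l₃.trans l₂)).trans v₁
  · exact (l₄.trans l₃).trans v₂
  · exact l₄.trans v₃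
  · exact v₄

end RealRAM

/-! ### The tournament tree -/

namespace RealRAM

/-- Node `j` of the tournament tree. The root is node `1`, the children of `j < n` are the nodes
`2 * j` and `2 * j + 1`, and the leaves are the nodes `n, …, 2 * n - 1`. -/
def State.node (s : State) (n j : ℕ) : ℝ := s.rmem (n + n + j)

/-- The inner nodes except `k` hold the maximum of their children. -/
def HeapExcept (n k : ℕ) (s : State) : Prop :=
  ∀ j, 1 ≤ j → j < n → j ≠ k → s.node n j = max (s.node n (j + j)) (s.node n (j + j + 1))

/-- The index memory holds the parents of the nodes. -/
def Parents (n : ℕ) (s : State) : Prop := ∀ j, 2 ≤ j → j < n + n → s.imem j = j / 2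

/-- The points, the number of points and the registers below `17` have not changed. -/
structure Frame (n : ℕ) (s s' : State) : Prop where
  ireg : s'.ireg 0 = s.ireg 0
  rreg : ∀ k < 17, s'.rreg k = s.rreg k
  rmem : ∀ m < n + n, s'.rmem m = s.rmem m

theorem Frame.refl (n : ℕ) (s : State) : Frame n s s := ⟨rfl, fun _ _ => rfl, fun _ _ => rfl⟩

/-- The points are `S`, with coordinates `X` and `Y` with respect to the corner `(a, b)` of their
rotated bounding box of size `W × H`. -/
structure Setting {n : ℕ} (S : Fin n → ℝ × ℝ) (v : ℝ) (a b : Bool) (X Y : Fin n → ℝ) (W H : ℝ)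
    (s : State) : Prop where
  size : s.ireg 0 = n
  fst : ∀ i : Fin n, s.rmem (i + i) = (S i).1
  snd : ∀ i : Fin n, s.rmem (i + i + 1) = (S i).2
  speed : s.rreg 6 = v
  x : ∀ i, coord a (s.rreg 8) (s.rreg 9) ((S i).1 + (S i).2) = X i
  y : ∀ i, coord b (s.rreg 10) (s.rreg 11) ((S i).1 - (S i).2) = Y i
  width : s.rreg 9 - s.rreg 8 = W
  height : s.rreg 11 - s.rreg 10 = H

/-- The points, the speed and the rotated bounding box have not changed. -/
structure Kept (n : ℕ) (s s' : State) : Prop where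
  ireg : s'.ireg 0 = s.ireg 0
  rreg : ∀ k, k = 6 ∨ (8 ≤ k ∧ k ≤ 11) → s'.rreg k = s.rreg k
  rmem : ∀ m < n + n, s'.rmem m = s.rmem m

theorem Kept.trans {n : ℕ} {s s' s'' : State} (h : Kept n s s') (h' : Kept n s' s'') :
    Kept n s s'' :=
  ⟨h'.ireg.trans h.ireg, fun k hk => (h'.rreg k hk).trans (h.rreg k hk),
    fun m hm => (h'.rmem m hm).trans (h.rmem m hm)⟩

theorem Frame.kept {n : ℕ} {s s' : State} (h : Frame n s s') : Kept n s s' :=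
  ⟨h.ireg, fun k hk => h.rreg k (by omega), h.rmem⟩

theorem SameInput.kept {n : ℕ} {s s' : State} (h : SameInput s s') : Kept n s s' :=
  ⟨congrFun h.ireg 0, fun k hk => h.rreg k (by omega) (by omega) (by omega),
    fun m _ => congrFun h.rmem m⟩

theorem Setting.congr {n : ℕ} {S : Fin n → ℝ × ℝ} {v : ℝ} {a b : Bool} {X Y : Fin n → ℝ} {W H : ℝ}
    {s s' : State} (h : Setting S v a b X Y W H s) (h' : Kept n s s') :
    Setting S v a b X Y W H s' := by
  obtain ⟨h1, h2, h3, h4, h5, h6, h7, h8⟩ := h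
  obtain ⟨h0, hr, hm⟩ := h'
  refine ⟨h0.trans h1, fun i => ?_, fun i => ?_, ?_, ?_, ?_, ?_, ?_⟩
  · rw [hm _ (by omega), h2]
  · rw [hm _ (by omega), h3]
  all_goals
    simpa only [hr 6 (by simp), hr 8 (by simp), hr 9 (by simp), hr 10 (by simp),
      hr 11 (by simp)]

theorem fill_spec {n M : ℕ} (hM : n + n + (n + n) ≤ M) {S : Fin n → ℝ × ℝ} {v : ℝ} {a b : Bool}
    {X Y : Fin n → ℝ} {W H : ℝ} {s₀ : State} (hs : Setting S v a b X Y W H s₀)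
    (h1 : s₀.ireg 1 = 0) :
    Runs M (fillLoop a b) s₀
      (((Test.ile (.reg 1 + .const 1) (.reg 0)).cost + 1 + (fillBody a b).worst) * (n + 1))
      fun s => Frame n s₀ s ∧ ∀ i : Fin n, s.node n (n + i) = max (X i) (Y i) := by
  refine (Runs.loop (N := n) (fun s => Frame n s₀ s ∧ s.ireg 1 ≤ n ∧ ∀ i : Fin n, i < s.ireg 1 →
    s.node n (n + i) = max (X i) (Y i)) (fun s => n - s.ireg 1) ?_ ?_ ?_).mono le_rfl ?_
  · rintro s ⟨hf, h1, hn⟩ hb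
    have hs' := hs.congr hf.kept
    have h0 := hs'.size
    simp only [Test.Holds, IExp.eval_add, IExp.eval_reg, IExp.eval_const, h0] at hb
    have hx := hs'.x ⟨s.ireg 1, hb⟩
    have hy := hs'.y ⟨s.ireg 1, hb⟩
    have hp1 := hs'.fst ⟨s.ireg 1, hb⟩
    have hp2 := hs'.snd ⟨s.ireg 1, hb⟩
    simp only at hp1 hp2
    simp only [fillBody, wp_block_cons, wp_block_nil, wp, IExp.eval_add, IExp.eval_reg,
      IExp.eval_const, eval_nodeE, h0, RExp.eval_max, eval_xE, eval_yE]
    simp [hp1, hp2, hx, hy]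
    refine ⟨by omega, by omega, by omega, ⟨⟨?_, ?_, ?_⟩, by omega, ?_⟩, by omega⟩
    · simp [hf.ireg]
    · intro k hk
      simp [hf.rreg k hk, show k ≠ 17 by omega, show k ≠ 18 by omega]
    · intro m hm
      simp [hf.rmem m hm, show m ≠ n + n + (n + s.ireg 1) by omega]
    · intro i hi
      rcases Nat.lt_or_eq_of_le hi with hi | hi
      · have := hn i hi
        simp only [State.node] at this ⊢
        rw [Function.update_of_ne (by omega), this]
      · simp only [State.node, hi]
        rw [Function.update_self]
        congr 2 <;> exact Fin.ext hi.symm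
  · exact ⟨.refl _ _, by omega, fun i hi => absurd hi (by omega)⟩
  · exact Nat.sub_le _ _
  · rintro s ⟨⟨hf, h1, hn⟩, hb⟩
    have h0 := (hs.congr hf.kept).size
    simp only [Test.Holds, IExp.eval_add, IExp.eval_reg, IExp.eval_const, h0] at hb
    exact ⟨hf, fun i => hn i (by omega)⟩

theorem build_spec {n M : ℕ} (hM : n + n + (n + n) ≤ M) (hn : 0 < n) {s₀ : State}
    (h0 : s₀.ireg 0 = n) (h2 : s₀.ireg 2 = n - 1) :
    Runs M buildLoop s₀ (((Test.ile (.const 1) (.reg 2)).cost + 1 + buildBody.worst) * (n + 1))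
      fun s => Frame n s₀ s ∧ HeapExcept n 0 s ∧ Parents n s ∧
        ∀ j, n ≤ j → s.node n j = s₀.node n j := by
  refine (Runs.loop (N := n) (fun s => Frame n s₀ s ∧ s.ireg 2 < n ∧
    (∀ j, s.ireg 2 < j → j < n → s.node n j = max (s.node n (j + j)) (s.node n (j + j + 1))) ∧
    (∀ j, 2 * s.ireg 2 + 2 ≤ j → j < n + n → s.imem j = j / 2) ∧
    ∀ j, n ≤ j → s.node n j = s₀.node n j) (fun s => s.ireg 2) ?_ ?_ ?_).mono le_rfl ?_
  · rintro s ⟨hf, hlt, hheap, hpar, hleaf⟩ hb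
    have h0' := hf.ireg.trans h0
    simp only [Test.Holds, IExp.eval_reg, IExp.eval_const] at hb
    simp only [buildBody, loadChildren, wp_block_cons, wp_block_nil, wp, IExp.eval_add,
      IExp.eval_sub, IExp.eval_reg, IExp.eval_const, eval_nodeE, h0', RExp.eval_max, RExp.eval_reg]
    simp only [State.node] at hheap hleaf ⊢
    simp [Function.update_apply]
    refine ⟨by omega, by omega, by omega, by omega, by omega, ⟨⟨?_, ?_, ?_⟩, by omega, ?_, ?_, ?_⟩,
      by omega⟩
    · simp [hf.ireg]
    · intro k hk
      simp [hf.rreg k hk, show k ≠ 17 by omega, show k ≠ 18 by omega]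
    · intro m hm
      simp [hf.rmem m hm, show m ≠ n + n + s.ireg 2 by omega]
    · intro j hj hjn
      rw [if_neg (show ¬ j + j = s.ireg 2 by omega),
        if_neg (show ¬ j + j + 1 = s.ireg 2 by omega)]
      split_ifs with h
      · rw [h]
      · exact hheap j (by omega) hjn
    · intro j hj hjn
      split_ifs with h h'
      · omega
      · omega
      · exact hpar j (by omega) hjn
    · intro j hj
      rw [if_neg (by omega), hleaf j hj]
  · exact ⟨.refl _ _, by omega, fun j h h' => absurd h (by omega),
      fun j h h' => absurd h (by omega), fun _ _ => rfl⟩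
  · omega
  · rintro s ⟨⟨hf, hlt, hheap, hpar, hleaf⟩, hb⟩
    simp only [Test.Holds, IExp.eval_reg, IExp.eval_const] at hb
    exact ⟨hf, fun j hj hjn _ => hheap j (by omega) hjn, fun j hj hjn => hpar j (by omega) hjn,
      hleaf⟩

/-- The root holds the maximum of all nodes. -/
theorem HeapExcept.node_le {n : ℕ} {s : State} (h : HeapExcept n 0 s) :
    ∀ j, 1 ≤ j → j < n + n → s.node n j ≤ s.node n 1 := by
  intro j
  induction j using Nat.strong_induction_on with
  | _ j ih =>
    intro h1 hj
    rcases Nat.eq_or_lt_of_le h1 with rfl | h1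
    · exact le_rfl
    · refine le_trans ?_ (ih (j / 2) (by omega) (by omega) (by omega))
      rw [h (j / 2) (by omega) (by omega) (by omega)]
      rcases Nat.even_or_odd' j with ⟨k, rfl | rfl⟩
      · rw [show 2 * k / 2 = k by omega, two_mul]
        exact le_max_left _ _
      · rw [show (2 * k + 1) / 2 = k by omega, two_mul]
        exact le_max_right _ _

theorem HeapExcept.exists_leaf {n : ℕ} {s : State} (h : HeapExcept n 0 s) :
    ∀ j, 1 ≤ j → j < n + n → ∃ i : Fin n, s.node n (n + i) = s.node n j := by
  intro j
  induction hd : n + n - j using Nat.strong_induction_on generalizing j with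
  | _ d ih =>
    intro h1 hj
    rcases Nat.lt_or_ge j n with hjn | hjn
    · rw [h j h1 hjn (by omega)]
      rcases max_choice (s.node n (j + j)) (s.node n (j + j + 1)) with hm | hm <;> rw [hm]
      · exact ih _ (by omega) (j + j) rfl (by omega) (by omega)
      · exact ih _ (by omega) (j + j + 1) rfl (by omega) (by omega)
    · exact ⟨⟨j - n, by omega⟩, by simp only [Nat.add_sub_cancel' hjn]⟩

theorem descend_spec {n M : ℕ} (hM : n + n + (n + n) ≤ M) (hn : 0 < n) {s₀ : State}
    (h0 : s₀.ireg 0 = n) (h2 : s₀.ireg 2 = 1) (hheap : HeapExcept n 0 s₀) :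
    Runs M descendLoop s₀
      (((Test.ile (.reg 2 + .const 1) (.reg 0)).cost + 1 + descendBody.worst) * (Nat.log 2 n + 2))
      fun s => Frame n s₀ s ∧ s.rmem = s₀.rmem ∧ s.imem = s₀.imem ∧
        ∃ i : Fin n, s.ireg 2 = n + i ∧ s.node n (n + i) = s.node n 1 := by
  refine (Runs.loop (N := Nat.log 2 n + 1) (fun s => Frame n s₀ s ∧ s.rmem = s₀.rmem ∧
    s.imem = s₀.imem ∧ 1 ≤ s.ireg 2 ∧ s.ireg 2 < n + n ∧ s₀.node n (s.ireg 2) = s₀.node n 1)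
    (fun s => Nat.log 2 n + 1 - Nat.log 2 (s.ireg 2)) ?_ ?_ ?_).mono le_rfl ?_
  · rintro s ⟨hf, hm, hm', h1, hlt, hroot⟩ hb
    have h0' := hf.ireg.trans h0
    simp only [Test.Holds, IExp.eval_add, IExp.eval_reg, IExp.eval_const, h0'] at hb
    have hlog : Nat.log 2 (s.ireg 2) ≤ Nat.log 2 n := Nat.log_mono_right (by omega)
    have hlog1 : Nat.log 2 (s.ireg 2 + s.ireg 2) = Nat.log 2 (s.ireg 2) + 1 := by
      rw [← mul_two, Nat.log_mul_base (by omega) (by omega)]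
    have hlog2 : Nat.log 2 (s.ireg 2) + 1 ≤ Nat.log 2 (s.ireg 2 + s.ireg 2 + 1) := by
      rw [← hlog1]
      exact Nat.log_mono_right (by omega)
    have hmax := hheap _ h1 (by omega) (by omega)
    simp only [State.node] at hmax hroot
    simp only [descendBody, loadChildren, wp_block_cons, wp_block_nil, wp, IExp.eval_add,
      IExp.eval_reg, IExp.eval_const, eval_nodeE, h0', hm, Test.Holds, RExp.eval_reg,
      State.node]
    simp
    have hframe : ∀ z, Frame n s₀ ⟨Function.update (Function.update s.rreg 17
        (s₀.rmem (n + n + (s.ireg 2 + s.ireg 2)))) 18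
        (s₀.rmem (n + n + (s.ireg 2 + s.ireg 2 + 1))), Function.update s.ireg 2 z, s₀.rmem,
        s.imem⟩ := by
      refine fun z => ⟨?_, fun k hk => ?_, fun _ _ => rfl⟩
      · simp [hf.ireg]
      · simp [hf.rreg k hk, show k ≠ 17 by omega, show k ≠ 18 by omega]
    refine ⟨by omega, by omega, fun hle => ⟨⟨hframe _, hm', by omega, by omega, ?_⟩, by omega⟩,
      fun hle => ⟨⟨hframe _, hm', by omega, ?_⟩, by omega⟩⟩
    · rw [← hroot, hmax, max_eq_left hle]
    · rw [← hroot, hmax, max_eq_right hle.le]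
  · exact ⟨.refl _ _, rfl, rfl, by omega, by omega, by rw [h2]⟩
  · exact Nat.sub_le _ _
  · rintro s ⟨⟨hf, hm, hm', h1, hlt, hroot⟩, hb⟩
    have h0' := hf.ireg.trans h0
    simp only [Test.Holds, IExp.eval_add, IExp.eval_reg, IExp.eval_const, h0'] at hb
    refine ⟨hf, hm, hm', ⟨s.ireg 2 - n, by omega⟩, by simp only; omega, ?_⟩
    simp only [State.node, hm] at hroot ⊢
    rw [← hroot]
    congr 2
    omega

theorem ascend_spec {n M : ℕ} (hM : n + n + (n + n) ≤ M) {s₀ : State}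
    (h0 : s₀.ireg 0 = n) {i : ℕ} (h2 : s₀.ireg 2 = i) (hi : 1 ≤ i) (hin : i < n + n)
    (hheap : HeapExcept n (i / 2) s₀) (hpar : Parents n s₀) :
    Runs M ascendLoop s₀
      (((Test.ile (.const 2) (.reg 2)).cost + 1 + ascendBody.worst) * (Nat.log 2 n + 2))
      fun s => Frame n s₀ s ∧ HeapExcept n 0 s ∧ Parents n s ∧
        ∀ j, n ≤ j → s.node n j = s₀.node n j := by
  refine (Runs.loop (N := Nat.log 2 n + 1) (fun s => Frame n s₀ s ∧ s.imem = s₀.imem ∧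
    1 ≤ s.ireg 2 ∧ s.ireg 2 < n + n ∧ HeapExcept n (s.ireg 2 / 2) s ∧
    ∀ j, n ≤ j → s.node n j = s₀.node n j) (fun s => Nat.log 2 (s.ireg 2)) ?_ ?_ ?_).mono le_rfl ?_
  · rintro s ⟨hf, hm, h1, hlt, hheap, hleaf⟩ hb
    have h0' := hf.ireg.trans h0
    simp only [Test.Holds, IExp.eval_reg, IExp.eval_const] at hb
    have hlog : Nat.log 2 (s.ireg 2 / 2) < Nat.log 2 (s.ireg 2) := by
      rw [Nat.log_div_base]
      have := Nat.log_pos (b := 2) (by omega) hb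
      omega
    have hp := hpar _ hb hlt
    simp only [HeapExcept, State.node] at hheap hleaf ⊢
    simp only [ascendBody, loadChildren, wp_block_cons, wp_block_nil, wp, IExp.eval_add,
      IExp.eval_reg, IExp.eval_const, eval_nodeE, hm, hp, RExp.eval_max,
      RExp.eval_reg]
    simp [Function.update_apply, h0']
    refine ⟨by omega, by omega, by omega, by omega, ⟨⟨?_, ?_, ?_⟩, by omega, by omega, ?_, ?_⟩,
      by omega⟩
    · simp [hf.ireg]
    · intro k hk
      simp [hf.rreg k hk, show k ≠ 17 by omega, show k ≠ 18 by omega]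
    · intro m hm
      simp [hf.rmem m hm, show m ≠ n + n + s.ireg 2 / 2 by omega]
    · intro j hj hjn hj'
      rw [if_neg (show ¬ j + j = s.ireg 2 / 2 by omega),
        if_neg (show ¬ j + j + 1 = s.ireg 2 / 2 by omega)]
      split_ifs with h
      · rw [h]
      · exact hheap j hj hjn h
    · intro j hj
      rw [if_neg (by omega), hleaf j hj]
  · exact ⟨.refl _ _, rfl, by omega, by omega, by rwa [h2], fun _ _ => rfl⟩
  · rw [h2]
    have : Nat.log 2 i ≤ Nat.log 2 (n * 2) := Nat.log_mono_right (by omega)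
    rwa [Nat.log_mul_base (by omega) (by omega)] at this
  · rintro s ⟨⟨hf, hm, h1, hlt, hheap, hleaf⟩, hb⟩
    simp only [Test.Holds, IExp.eval_reg, IExp.eval_const] at hb
    rw [show s.ireg 2 / 2 = 0 by omega] at hheap
    exact ⟨hf, hheap, fun j h h' => by rw [hm, hpar j h h'], hleaf⟩

end RealRAM

/-! ### The main loop -/

namespace RealRAM

open Turnpike

section

variable {n M : ℕ} {S : Fin n → ℝ × ℝ} {v : ℝ} {a b : Bool} {X Y : Fin n → ℝ} {W H : ℝ}

theorem isBox_insert {D D' : Set (Fin n)} {b₁ b₂ d₁ d₂ : ℝ} {i : Fin n}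
    (h : IsBox X Y W H D b₁ b₂ d₁ d₂) (hD : ∀ j, j ∈ D' ↔ j = i ∨ j ∈ D) :
    IsBox X Y W H D' (min b₁ (X i)) (max b₂ (X i)) (min d₁ (Y i)) (max d₂ (Y i)) := by
  simp only [show D' = {j | j = i ∨ j ∈ D} from Set.ext hD]
  refine ⟨?_, ?_, ?_, ?_, ?_, ?_, ?_, ?_, min_le_of_left_le h.left_le,
    le_max_of_le_left h.zero_le_right, min_le_of_left_le h.bottom_le,
    le_max_of_le_left h.zero_le_top⟩
  · rintro j (rfl | hj)
    · exact min_le_right _ _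
    · exact (min_le_left _ _).trans (h.left j hj)
  · rintro j (rfl | hj)
    · exact le_max_right _ _
    · exact (h.right j hj).trans (le_max_left _ _)
  · rintro j (rfl | hj)
    · exact min_le_right _ _
    · exact (min_le_left _ _).trans (h.bottom j hj)
  · rintro j (rfl | hj)
    · exact le_max_right _ _
    · exact (h.top j hj).trans (le_max_left _ _)
  · exact fun z hz hj => le_min (h.le_left z hz fun j hD => hj j (.inr hD)) (hj i (.inl rfl))
  · exact fun z hz hj => max_le (h.right_le z hz fun j hD => hj j (.inr hD)) (hj i (.inl rfl))
  · exact fun z hz hj => le_min (h.le_bottom z hz fun j hD => hj j (.inr hD)) (hj i (.inl rfl))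
  · exact fun z hz hj => max_le (h.top_le z hz fun j hD => hj j (.inr hD)) (hj i (.inl rfl))

theorem remove_spec (hM : n + n + (n + n) ≤ M) {s : State} (hs : Setting S v a b X Y W H s)
    {i : Fin n} (h2 : s.ireg 2 = n + i) :
    wp M (removeCmd a b) (fun s' => s'.ireg = s.ireg ∧ s'.imem = s.imem ∧
      (∀ k < 12, s'.rreg k = s.rreg k) ∧
      (∀ m, m ≠ n + n + (n + i) → s'.rmem m = s.rmem m) ∧ s'.node n (n + i) = -1 ∧
      s'.rreg 12 = min (s.rreg 12) (X i) ∧ s'.rreg 13 = max (s.rreg 13) (X i) ∧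
      s'.rreg 14 = min (s.rreg 14) (Y i) ∧ s'.rreg 15 = max (s.rreg 15) (Y i)) s := by
  have h0 := hs.size
  have e : n + (i : ℕ) + (n + i) - (n + n) = i + i := by omega
  have hi := i.isLt
  simp only [removeCmd, wp_block_cons, wp_block_nil, wp, IExp.eval_add, IExp.eval_sub,
    IExp.eval_reg, IExp.eval_const, eval_nodeE, h0, h2, e, hs.fst, hs.snd, RExp.eval_min,
    RExp.eval_max, eval_xE, eval_yE, RExp.eval_reg, RExp.eval_const, State.node]
  simp [hs.x, hs.y]
  refine ⟨by omega, by omega, by omega, fun k hk => ?_, fun m hm => ?_⟩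
  · simp only [Function.update_apply]
    simp only [if_neg (show k ≠ 12 by omega), if_neg (show k ≠ 13 by omega),
      if_neg (show k ≠ 14 by omega), if_neg (show k ≠ 15 by omega), if_neg (show k ≠ 17 by omega),
      if_neg (show k ≠ 18 by omega)]
  · rw [Function.update_of_ne hm]

/-- The invariant of the main loop. The points with leaf `-1` use the turnpike. All of them have at
least the key at the root, which is the largest key of the other points. A radius `R` for which
the corner is feasible has been beaten as soon as no point with a key above `2 * R` is left. -/
structure MainInv (S : Fin n → ℝ × ℝ) (v : ℝ) (X Y : Fin n → ℝ) (W H B : ℝ)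
    (s₀ s : State) : Prop where
  kept : Kept n s₀ s
  heap : HeapExcept n 0 s
  parents : Parents n s
  root : s.rreg 16 = s.node n 1
  leaf : ∀ i : Fin n, s.node n (n + i) = max (X i) (Y i) ∨
    (s.node n (n + i) = -1 ∧ s.node n 1 ≤ max (X i) (Y i))
  box : IsBox X Y W H {i | s.node n (n + i) = -1} (s.rreg 12) (s.rreg 13) (s.rreg 14) (s.rreg 15)
  good : Good v S s
  le : s.rreg 7 ≤ B
  corner : ∀ R, CornerFeasible v X Y W H R → s.node n 1 ≤ 2 * R → s.rreg 7 ≤ R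

/-- The number of points that do not use the turnpike. -/
noncomputable def walkers (n : ℕ) (s : State) : ℕ :=
  (Finset.univ.filter fun i : Fin n => s.node n (n + i) ≠ -1).card

/-- The running time of the body of the main loop is at most this constant times
`Nat.log 2 n + 2`. -/
def bodyCost (a b : Bool) : ℕ :=
  (Cmd.iset 2 (.const 1)).worst +
    (((Test.ile (.reg 2 + .const 1) (.reg 0)).cost + 1 + descendBody.worst) +
      ((removeCmd a b).worst + (((Test.ile (.const 2) (.reg 2)).cost + 1 + ascendBody.worst) +
        (loadRoot.worst + (candidatesCmd a b).worst))))

theorem mainBody_spec (hM : n + n + (n + n) ≤ M) (hn : 0 < n) (hv : 1 < v) {s₀ s : State} {B : ℝ}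
    (hs₀ : Setting S v a b X Y W H s₀) (hX : ∀ i, 0 ≤ X i ∧ X i ≤ W) (hY : ∀ i, 0 ≤ Y i ∧ Y i ≤ H)
    (h : MainInv S v X Y W H B s₀ s) (hroot : 0 ≤ s.rreg 16) :
    Runs M (mainBody a b) s (bodyCost a b * (Nat.log 2 n + 2))
      fun s' => MainInv S v X Y W H B s₀ s' ∧ walkers n s' < walkers n s := by
  have hs := hs₀.congr h.kept
  set s₁ : State := { s with ireg := Function.update s.ireg 2 1 } with hs₁
  have hs₁' : Setting S v a b X Y W H s₁ := hs.congr ⟨by simp [hs₁], fun _ _ => rfl, fun _ _ => rfl⟩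
  have hseq : Runs M (mainBody a b) s
      ((Cmd.iset 2 (.const 1)).worst +
        (((Test.ile (.reg 2 + .const 1) (.reg 0)).cost + 1 + descendBody.worst) *
          (Nat.log 2 n + 2) + ((removeCmd a b).worst +
            (((Test.ile (.const 2) (.reg 2)).cost + 1 + ascendBody.worst) * (Nat.log 2 n + 2) +
              (loadRoot.worst + (candidatesCmd a b).worst)))))
      fun s' => MainInv S v X Y W H B s₀ s' ∧ walkers n s' < walkers n s := by
    refine Runs.seq (P := fun s' => s' = s₁) (wp.runs rfl) ?_
    rintro _ rfl
    refine Runs.seq (descend_spec hM hn hs₁'.size (by simp [hs₁]) h.heap) ?_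
    rintro s₂ ⟨hf₂, hm₂, hm₂', i, hi, hi'⟩
    have hs₂ := hs₁'.congr hf₂.kept
    refine Runs.seq (wp.runs (remove_spec hM hs₂ hi)) ?_
    rintro s₃ ⟨e1, e2, e3, e4, e5, e6, e7, e8, e9⟩
    have hilt := i.isLt
    have hnode₂ : ∀ j, s₂.node n j = s.node n j := fun j => congrFun hm₂ _
    have hnode₃ : ∀ j, j ≠ n + i → s₃.node n j = s.node n j := fun j hj =>
      (e4 _ (by omega)).trans (hnode₂ j)
    simp only [hnode₂] at hi'
    -- removing the leaf may violate the heap condition at its parent only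
    have hheap₃ : HeapExcept n ((n + i) / 2) s₃ := by
      intro j hj hjn hj'
      rw [hnode₃ _ (by omega), hnode₃ _ (by omega), hnode₃ _ (by omega)]
      exact h.heap j hj hjn (by omega)
    have hpar₃ : Parents n s₃ := fun j hj hj' => by
      rw [e2, hm₂']
      exact h.parents j hj hj'
    refine Runs.seq (ascend_spec hM (by rw [e1]; exact hs₂.size) (by rw [e1, hi]) (by omega)
      (by omega) hheap₃ hpar₃) ?_
    rintro s₄ ⟨hf₄, hheap₄, hpar₄, hleaf₄⟩
    set s₅ : State := { s₄ with rreg := Function.update s₄.rreg 16 (s₄.node n 1) } with hs₅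
    have h40 : s₄.ireg 0 = n := by rw [hf₄.ireg, e1, hs₂.size]
    have hload : wp M loadRoot (fun s' => s' = s₅) s₄ := by
      simp only [loadRoot, wp, eval_nodeE, h40, IExp.eval_const]
      exact ⟨by omega, rfl⟩
    refine Runs.seq (wp.runs hload) ?_
    rintro _ rfl
    have hne₅ : ∀ k, k ≠ 16 → s₅.rreg k = s₄.rreg k := fun k hk => Function.update_of_ne hk _ _
    have hreg₅ : ∀ k < 12, s₅.rreg k = s.rreg k := fun k hk => by
      rw [hne₅ k (by omega), hf₄.rreg k (by omega), e3 k hk,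
        hf₂.rreg k (by omega)]
    have hkept₅ : Kept n s s₅ := by
      refine ⟨h40.trans hs.size.symm, fun k hk => hreg₅ k (by omega), fun m hm => ?_⟩
      rw [hs₅, hf₄.rmem m hm, e4 m (by omega), hm₂]
    have hs₅' := hs.congr hkept₅
    have hnode₅ : ∀ j, s₅.node n j = s₄.node n j := fun _ => rfl
    have hheap₅ : HeapExcept n 0 s₅ := hheap₄
    have hleaf₅ : ∀ j : Fin n, s₅.node n (n + j) = if j = i then -1 else s.node n (n + j) := by
      intro j
      rw [hnode₅, hleaf₄ _ (by omega)]
      split_ifs with hj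
      · rw [hj, e5]
      · exact hnode₃ _ fun hj' => hj (Fin.ext (by omega))
    have hroot₅ : s₅.rreg 16 = s₅.node n 1 := by simp [hs₅, State.node]
    rw [h.root] at hroot
    have hkey : s.node n 1 = max (X i) (Y i) := by
      rcases h.leaf i with hl | hl
      · rw [← hi', hl]
      · rw [hi'] at hl
        linarith [hl.1]
    have hle : s₅.node n 1 ≤ s.node n 1 := by
      obtain ⟨j, hj⟩ := hheap₅.exists_leaf 1 le_rfl (by omega)
      rw [← hj, hleaf₅]
      split_ifs
      · linarith
      · exact h.heap.node_le _ (by omega) (by omega)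
    have hinv : ∀ j : Fin n, s₅.node n (n + j) = max (X j) (Y j) ∨
        (s₅.node n (n + j) = -1 ∧ s.node n 1 ≤ max (X j) (Y j)) := by
      intro j
      rw [hleaf₅]
      split_ifs with hj
      · exact .inr ⟨rfl, by rw [hj, hkey]⟩
      · exact h.leaf j
    have hbox : IsBox X Y W H {j | s₅.node n (n + j) = -1} (s₅.rreg 12) (s₅.rreg 13) (s₅.rreg 14)
        (s₅.rreg 15) := by
      have hr : ∀ k, 12 ≤ k ∧ k < 16 → s₅.rreg k = s₃.rreg k := fun k hk => by
        rw [hne₅ k (by omega), hf₄.rreg k (by omega)]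
      have hr' : ∀ k < 17, s₂.rreg k = s.rreg k := hf₂.rreg
      rw [hr 12 (by simp), hr 13 (by simp), hr 14 (by simp), hr 15 (by simp), e6, e7, e8, e9,
        hr' 12 (by simp), hr' 13 (by simp), hr' 14 (by simp), hr' 15 (by simp)]
      refine isBox_insert h.box fun j => ?_
      simp only [Set.mem_ofPred_eq, hleaf₅]
      by_cases hj : j = i <;> simp [hj]
    have hserved : Served S a b s₅ := by
      constructor
      · simpa only [hs₅'.x, hs₅'.width] using hX
      · simpa only [hs₅'.y, hs₅'.height] using hY
      · simp only [hs₅'.x, hs₅'.y]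
        intro j
        rcases hinv j with hj | ⟨hj, -⟩
        · left
          rw [← hj, hroot₅]
          exact hheap₅.node_le _ (by omega) (by omega)
        · exact .inr ⟨⟨hbox.left j hj, hbox.right j hj⟩, hbox.bottom j hj, hbox.top j hj⟩
    have hgood : Good (s₅.rreg 6) S s₅ := by
      rw [hs₅'.speed]
      intro j
      simp only [State.point]
      norm_num
      rw [hreg₅ 0 (by simp), hreg₅ 1 (by simp), hreg₅ 2 (by simp), hreg₅ 3 (by simp),
        hreg₅ 4 (by simp), hreg₅ 5 (by simp), hreg₅ 7 (by simp)]
      exact h.good j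
    refine (wp.runs (candidates_spec hserved hgood)).mono le_rfl ?_
    rintro s₆ ⟨hsame, hgood₆, hle₆, hval₆⟩
    have hnode₆ : ∀ j, s₆.node n j = s₅.node n j := fun j => congrFun hsame.rmem _
    rw [hreg₅ 7 (by simp)] at hle₆
    rw [hs₅'.speed] at hgood₆
    refine ⟨⟨h.kept.trans (hkept₅.trans hsame.kept), ?_, ?_, ?_, ?_, ?_, hgood₆, hle₆.trans h.le,
      ?_⟩, ?_⟩
    · simpa only [HeapExcept, hnode₆] using hheap₅
    · intro j hj hj'
      rw [hsame.imem]
      exact hpar₄ j hj hj'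
    · rw [hsame.rreg 16 (by simp) (by simp) (by simp), hnode₆, hroot₅]
    · simp only [hnode₆]
      exact fun j => (hinv j).imp_right fun hj => ⟨hj.1, hle.trans hj.2⟩
    · simp only [hnode₆]
      rw [hsame.rreg 12 (by simp) (by simp) (by simp), hsame.rreg 13 (by simp) (by simp) (by simp),
        hsame.rreg 14 (by simp) (by simp) (by simp), hsame.rreg 15 (by simp) (by simp) (by simp)]
      exact hbox
    · intro R hR hκ
      rw [hnode₆] at hκ
      rcases le_or_gt (s.node n 1) (2 * R) with hκ' | hκ'
      · exact hle₆.trans (h.corner R hR hκ')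
      · -- the turnpike users are exactly the points with a key above `2 * R`
        have hset : {j : Fin n | s₅.node n (n + j) = -1} = {j | 2 * R < max (X j) (Y j)} := by
          ext j
          simp only [Set.mem_ofPred_eq]
          constructor
          · intro hj
            rcases hinv j with hj' | hj'
            · have : 0 ≤ max (X j) (Y j) := le_max_of_le_left (hX j).1
              linarith
            · linarith [hj'.2]
          · intro hj
            rcases hinv j with hj' | hj'
            · have := hheap₅.node_le (n + j) (by omega) (by omega)
              linarith
            · exact hj'.1
        rw [hset] at hbox
        obtain ⟨k, hk⟩ := Data.exists_candidate_of_feasible (P := s₅.data) (R := R)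
          (by simpa [State.data, hs₅'.speed] using hv) (by simpa [State.data, hroot₅] using hκ)
          (by simpa [State.data, hs₅'.speed, hs₅'.width, hs₅'.height] using
            hR.feasible _ _ _ _ hbox)
        exact (hval₆ k).trans hk
    · refine Finset.card_lt_card ((Finset.ssubset_iff_of_subset ?_).2 ⟨i, ?_, ?_⟩)
      · intro j
        simp only [hnode₆, hleaf₅, Finset.mem_filter, Finset.mem_univ, true_and]
        split_ifs <;> simp
      · simp only [hi', Finset.mem_filter, Finset.mem_univ, true_and]
        linarith
      · simp [hnode₆, hleaf₅]
  refine hseq.mono ?_ fun _ h => h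
  have hlog : ∀ c, c ≤ c * (Nat.log 2 n + 2) := fun c => Nat.le_mul_of_pos_right c (by omega)
  simp only [bodyCost, add_mul]
  gcongr <;> exact hlog _

/-- What holds after a corner has been searched. -/
structure Searched (S : Fin n → ℝ × ℝ) (v : ℝ) (X Y : Fin n → ℝ) (W H : ℝ)
    (s₀ s : State) : Prop where
  kept : Kept n s₀ s
  good : Good v S s
  le : s.rreg 7 ≤ s₀.rreg 7
  corner : ∀ R, CornerFeasible v X Y W H R → s.rreg 7 ≤ R

/-- The running time of the search at a corner is at most this constant times
`(n + 1) * (Nat.log 2 n + 2)`. -/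
def cornerCost (a b : Bool) : ℕ :=
  (Cmd.iset 1 (.const 0)).worst +
    (((Test.ile (.reg 1 + .const 1) (.reg 0)).cost + 1 + (fillBody a b).worst) +
      ((Cmd.iset 2 (.reg 0 - .const 1)).worst +
        (((Test.ile (.const 1) (.reg 2)).cost + 1 + buildBody.worst) +
          (initBox.worst + ((Test.rle (.const 0) (.reg 16)).cost + 1 + bodyCost a b)))))

theorem corner_spec (hM : n + n + (n + n) ≤ M) (hn : 0 < n) (hv : 1 < v) {s : State}
    (hs : Setting S v a b X Y W H s) (hX : ∀ i, 0 ≤ X i ∧ X i ≤ W) (hY : ∀ i, 0 ≤ Y i ∧ Y i ≤ H)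
    (hW : ∃ i, X i = W) (hH : ∃ i, Y i = H) (hg : Good v S s) :
    Runs M (cornerCmd a b) s (cornerCost a b * ((n + 1) * (Nat.log 2 n + 2)))
      (Searched S v X Y W H s) := by
  set s₁ : State := { s with ireg := Function.update s.ireg 1 0 } with hs₁
  have hk₁ : Kept n s s₁ := ⟨by simp [hs₁], fun _ _ => rfl, fun _ _ => rfl⟩
  have hseq : Runs M (cornerCmd a b) s
      ((Cmd.iset 1 (.const 0)).worst +
        (((Test.ile (.reg 1 + .const 1) (.reg 0)).cost + 1 + (fillBody a b).worst) * (n + 1) +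
          ((Cmd.iset 2 (.reg 0 - .const 1)).worst +
            (((Test.ile (.const 1) (.reg 2)).cost + 1 + buildBody.worst) * (n + 1) +
              (initBox.worst + (n * ((Test.rle (.const 0) (.reg 16)).cost + 1 +
                bodyCost a b * (Nat.log 2 n + 2)) + ((Test.rle (.const 0) (.reg 16)).cost + 1)))))))
      (Searched S v X Y W H s) := by
    refine Runs.seq (P := fun s' => s' = s₁) (wp.runs rfl) ?_
    rintro _ rfl
    refine Runs.seq (fill_spec hM (hs.congr hk₁) (by simp [hs₁])) ?_
    rintro s₂ ⟨hf₂, hleaf₂⟩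
    have hk₂ := hk₁.trans hf₂.kept
    set s₃ : State := { s₂ with ireg := Function.update s₂.ireg 2 (n - 1) } with hs₃
    have hk₃ : Kept n s s₃ := hk₂.trans ⟨by simp [hs₃], fun _ _ => rfl, fun _ _ => rfl⟩
    refine Runs.seq (P := fun s' => s' = s₃) (wp.runs ?_) ?_
    · simp [wp, hs₃, (hs.congr hk₂).size]
    rintro _ rfl
    refine Runs.seq (build_spec hM hn (hs.congr hk₃).size (by simp [hs₃])) ?_
    rintro s₄ ⟨hf₄, hheap₄, hpar₄, hleaf₄⟩
    have hk₄ := hk₃.trans hf₄.kept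
    have hs₄ := hs.congr hk₄
    have hreg₄ : ∀ k < 12, s₄.rreg k = s.rreg k := fun k hk => by
      rw [hf₄.rreg k (by omega), hs₃, hf₂.rreg k (by omega), hs₁]
    have hkey₄ : ∀ i : Fin n, s₄.node n (n + i) = max (X i) (Y i) := fun i => by
      rw [hleaf₄ _ (by omega)]
      exact hleaf₂ i
    refine Runs.seq (P := MainInv S v X Y W H (s.rreg 7) s) (wp.runs ?_) ?_
    · simp only [initBox, loadRoot, wp_block_cons, wp_block_nil, wp, eval_nodeE, RExp.eval_sub,
        RExp.eval_reg, RExp.eval_const, IExp.eval_const, hs₄.size]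
      refine ⟨by omega, ?_⟩
      have hempty : {i : Fin n | s₄.node n (n + i) = -1} = ∅ := by
        ext i
        simp only [hkey₄, Set.mem_ofPred_eq, Set.mem_empty_iff_false, iff_false]
        have : 0 ≤ max (X i) (Y i) := le_max_of_le_left (hX i).1
        linarith
      obtain ⟨i, hi⟩ := hW
      obtain ⟨j, hj⟩ := hH
      refine ⟨⟨hk₄.ireg, fun k hk => ?_, hk₄.rmem⟩, hheap₄, hpar₄, ?_, fun i => .inl (hkey₄ i), ?_,
        ?_, ?_, fun R hR hκ => ?_⟩
      · rw [← hreg₄ k (by omega)]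
        simp [show k ≠ 12 by omega, show k ≠ 13 by omega,
          show k ≠ 14 by omega, show k ≠ 15 by omega, show k ≠ 16 by omega]
      · simp [State.node]
      · change IsBox X Y W H {i : Fin n | s₄.node n (n + i) = -1} _ _ _ _
        rw [hempty]
        have := hX i
        have := hY i
        constructor <;> simp [hs₄.width, hs₄.height]
      · intro i
        simp [State.point]
        rw [hreg₄ 0 (by simp), hreg₄ 1 (by simp), hreg₄ 2 (by simp), hreg₄ 3 (by simp),
          hreg₄ 4 (by simp), hreg₄ 5 (by simp), hreg₄ 7 (by simp)]
        exact hg i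
      · simp [hreg₄]
      · -- at the beginning the root is at least `max W H`
        exfalso
        have hκ' : s₄.node n 1 ≤ 2 * R := hκ
        have hlt := hR.lt
        have hi' := hheap₄.node_le (n + i) (by omega) (by omega)
        have hj' := hheap₄.node_le (n + j) (by omega) (by omega)
        rw [hkey₄, max_le_iff] at hi' hj'
        have := max_le (hi ▸ hi'.1) (hj ▸ hj'.2)
        linarith
    · intro s₅ hs₅
      refine (Runs.while_loop (MainInv S v X Y W H (s.rreg 7) s) (walkers n)
        (fun s' h hb => ?_) n s₅ hs₅ ?_).mono le_rfl ?_
      · simp only [Test.Holds, RExp.eval_const, RExp.eval_reg, Rat.cast_zero] at hb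
        exact mainBody_spec hM hn hv hs hX hY h hb
      · exact (Finset.card_le_univ _).trans (by simp)
      · rintro s' ⟨h, hb⟩
        simp only [Test.Holds, RExp.eval_const, RExp.eval_reg, Rat.cast_zero, not_le] at hb
        refine ⟨h.kept, h.good, h.le, fun R hR => h.corner R hR ?_⟩
        have := h.root
        have := hR.nonneg
        linarith
  refine hseq.mono ?_ fun _ h => h
  have h1 : ∀ c, c ≤ c * ((n + 1) * (Nat.log 2 n + 2)) := fun c =>
    Nat.le_mul_of_pos_right c (by positivity)
  have h2 : ∀ c, c * (n + 1) ≤ c * ((n + 1) * (Nat.log 2 n + 2)) := fun c =>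
    Nat.mul_le_mul_left c (Nat.le_mul_of_pos_right _ (by omega))
  have h3 : ∀ c d, n * (c + d * (Nat.log 2 n + 2)) + c ≤
      (c + d) * ((n + 1) * (Nat.log 2 n + 2)) := fun c d => by
    nlinarith [Nat.zero_le (c * n * Nat.log 2 n), Nat.zero_le (c * Nat.log 2 n),
      Nat.zero_le (c * n), Nat.zero_le (d * Nat.log 2 n)]
  unfold cornerCost
  simp only [add_mul _ _ ((n + 1) * (Nat.log 2 n + 2))] at *
  have := h3 ((Test.rle (.const 0) (.reg 16)).cost + 1) (bodyCost a b)
  have := h1 (Cmd.iset 1 (.const 0)).worst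
  have := h2 ((Test.ile (.reg 1 + .const 1) (.reg 0)).cost + 1 + (fillBody a b).worst)
  have := h1 (Cmd.iset 2 (.reg 0 - .const 1)).worst
  have := h2 ((Test.ile (.const 1) (.reg 2)).cost + 1 + buildBody.worst)
  have := h1 initBox.worst
  simp only [add_mul _ _ ((n + 1) * (Nat.log 2 n + 2))] at *
  omega

end

end RealRAM

/-! ### The whole program -/

namespace RealRAM

open Turnpike

theorem input_fst {n : ℕ} (S : Fin n → ℝ × ℝ) (v : ℝ) (i : Fin n) :
    (input S v).rmem (i + i) = (S i).1 := by
  have h : ((i : ℕ) + i) / 2 = i := by omega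
  have h' : ((i : ℕ) + i) % 2 = 0 := by omega
  simp [input, h, h']

theorem input_snd {n : ℕ} (S : Fin n → ℝ × ℝ) (v : ℝ) (i : Fin n) :
    (input S v).rmem (i + i + 1) = (S i).2 := by
  have h : ((i : ℕ) + i + 1) / 2 = i := by omega
  have h' : ((i : ℕ) + i + 1) % 2 = 1 := by omega
  simp [input, h, h']

/-- The registers `8, …, 11` bound the rotated coordinates of the points with index below `m`, and
these bounds are attained. -/
structure Hull {n : ℕ} (S : Fin n → ℝ × ℝ) (v : ℝ) (m : ℕ) (s : State) : Prop where
  size : s.ireg 0 = n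
  rmem : s.rmem = (input S v).rmem
  speed : s.rreg 6 = v
  left : ∀ i : Fin n, i < m → s.rreg 8 ≤ (S i).1 + (S i).2
  right : ∀ i : Fin n, i < m → (S i).1 + (S i).2 ≤ s.rreg 9
  bottom : ∀ i : Fin n, i < m → s.rreg 10 ≤ (S i).1 - (S i).2
  top : ∀ i : Fin n, i < m → (S i).1 - (S i).2 ≤ s.rreg 11
  exists_left : ∃ i, (S i).1 + (S i).2 = s.rreg 8
  exists_right : ∃ i, (S i).1 + (S i).2 = s.rreg 9
  exists_bottom : ∃ i, (S i).1 - (S i).2 = s.rreg 10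
  exists_top : ∃ i, (S i).1 - (S i).2 = s.rreg 11

theorem hullInit_spec {n M : ℕ} (hM : n + n + (n + n) ≤ M) (hn : 0 < n) (S : Fin n → ℝ × ℝ)
    (v : ℝ) : wp M hullInit (fun s => s.ireg 1 = 0 ∧ Hull S v 0 s) (input S v) := by
  have h0 := input_fst S v ⟨0, hn⟩
  have h1 := input_snd S v ⟨0, hn⟩
  simp only [add_zero, zero_add] at h0 h1
  simp [hullInit, wp, h0, h1]
  refine ⟨by omega, by omega, rfl, ?_⟩
  constructor <;> simp <;> rfl

/-- Extending an attained lower bound by one more value. -/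
theorem exists_eq_min {ι : Type*} {f : ι → ℝ} {z : ℝ} (h : ∃ i, f i = z) (j : ι) :
    ∃ i, f i = min z (f j) := by
  rcases min_choice z (f j) with e | e <;> rw [e]
  · exact h
  · exact ⟨j, rfl⟩

/-- Extending an attained upper bound by one more value. -/
theorem exists_eq_max {ι : Type*} {f : ι → ℝ} {z : ℝ} (h : ∃ i, f i = z) (j : ι) :
    ∃ i, f i = max z (f j) := by
  rcases max_choice z (f j) with e | e <;> rw [e]
  · exact h
  · exact ⟨j, rfl⟩

theorem hull_spec {n M : ℕ} (hM : n + n + (n + n) ≤ M) {S : Fin n → ℝ × ℝ} {v : ℝ}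
    {s₀ : State} (h1 : s₀.ireg 1 = 0) (h : Hull S v 0 s₀) :
    Runs M hullLoop s₀
      (((Test.ile (.reg 1 + .const 1) (.reg 0)).cost + 1 + hullBody.worst) * (n + 1))
      (Hull S v n) := by
  refine (Runs.loop (N := n) (fun s => s.ireg 1 ≤ n ∧ Hull S v (s.ireg 1) s)
    (fun s => n - s.ireg 1) ?_ ?_ ?_).mono le_rfl ?_
  · rintro s ⟨h1, hs⟩ hb
    have h0 := hs.size
    simp only [Test.Holds, IExp.eval_add, IExp.eval_reg, IExp.eval_const, h0] at hb
    have hp1 := input_fst S v ⟨s.ireg 1, hb⟩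
    have hp2 := input_snd S v ⟨s.ireg 1, hb⟩
    simp only at hp1 hp2
    simp only [hullBody, wp_block_cons, wp_block_nil, wp, IExp.eval_add, IExp.eval_reg,
      IExp.eval_const, RExp.eval_max, RExp.eval_min, RExp.eval_add, RExp.eval_sub, RExp.eval_reg,
      hs.rmem, hp1, hp2]
    simp
    have hlt : ∀ i : Fin n, (i : ℕ) ≤ s.ireg 1 → (i : ℕ) < s.ireg 1 ∨ i = ⟨s.ireg 1, hb⟩ :=
      fun i hi => (Nat.lt_or_eq_of_le hi).imp_right Fin.ext
    refine ⟨by omega, by omega, ⟨by omega, ?_⟩, by omega⟩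
    constructor <;> simp [-tsub_le_iff_right]
    · exact h0
    · exact hs.speed
    · intro i hi
      rcases hlt i (by omega) with hi | rfl
      · exact .inl (hs.left i hi)
      · exact .inr le_rfl
    · intro i hi
      rcases hlt i (by omega) with hi | rfl
      · exact .inl (hs.right i hi)
      · exact .inr le_rfl
    · intro i hi
      rcases hlt i (by omega) with hi | rfl
      · exact .inl (hs.bottom i hi)
      · exact .inr le_rfl
    · intro i hi
      rcases hlt i (by omega) with hi | rfl
      · exact .inl (hs.top i hi)
      · exact .inr le_rfl
    · exact exists_eq_min (f := fun i => (S i).1 + (S i).2) hs.exists_left _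
    · exact exists_eq_max (f := fun i => (S i).1 + (S i).2) hs.exists_right _
    · exact exists_eq_min (f := fun i => (S i).1 - (S i).2) hs.exists_bottom _
    · exact exists_eq_max (f := fun i => (S i).1 - (S i).2) hs.exists_top _
  · exact ⟨by omega, by rwa [h1]⟩
  · exact Nat.sub_le _ _
  · rintro s ⟨⟨h1, hs⟩, hb⟩
    simp only [Test.Holds, IExp.eval_add, IExp.eval_reg, IExp.eval_const, hs.size] at hb
    rwa [show s.ireg 1 = n by omega] at hs

theorem Hull.setting {n : ℕ} {S : Fin n → ℝ × ℝ} {v : ℝ} {s : State} (h : Hull S v n s)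
    (a b : Bool) :
    Setting S v a b (fun i => coord a (s.rreg 8) (s.rreg 9) ((S i).1 + (S i).2))
      (fun i => coord b (s.rreg 10) (s.rreg 11) ((S i).1 - (S i).2))
      (s.rreg 9 - s.rreg 8) (s.rreg 11 - s.rreg 10) s :=
  ⟨h.size, fun i => h.rmem ▸ input_fst S v i, fun i => h.rmem ▸ input_snd S v i, h.speed,
    fun _ => rfl, fun _ => rfl, rfl, rfl⟩

theorem travelTime_le_walk {v : ℝ} (f t t' p : ℝ × ℝ) :
    travelTime v f t t' p ≤ max |(p.1 + p.2) - (f.1 + f.2)| |(p.1 - p.2) - (f.1 - f.2)| := by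
  rw [← l1Dist_eq_max]
  exact min_le_left _ _

theorem walk_spec {n M : ℕ} {S : Fin n → ℝ × ℝ} {v : ℝ} {s : State} (h : Hull S v n s) :
    wp M walkCmd (fun s' => Hull S v n s' ∧ Good v S s' ∧
      s'.rreg 7 = max (s'.rreg 9 - s'.rreg 8) (s'.rreg 11 - s'.rreg 10) / 2) s := by
  simp [walkCmd, wp]
  constructor
  · obtain ⟨h1, h2, h3, h4, h5, h6, h7, h8, h9, h10, h11⟩ := h
    have h4' := fun i : Fin n => h4 i i.isLt
    have h5' := fun i : Fin n => h5 i i.isLt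
    have h6' := fun i : Fin n => h6 i i.isLt
    have h7' := fun i : Fin n => h7 i i.isLt
    constructor <;> simpa [-tsub_le_iff_right]
  · intro i
    refine (travelTime_le_walk _ _ _ _).trans ?_
    have h1 := h.left i i.isLt
    have h2 := h.right i i.isLt
    have h3 := h.bottom i i.isLt
    have h4 := h.top i i.isLt
    have h5 := le_max_left (s.rreg 9 - s.rreg 8) (s.rreg 11 - s.rreg 10)
    have h6 := le_max_right (s.rreg 9 - s.rreg 8) (s.rreg 11 - s.rreg 10)
    simp only [State.point]
    simp [abs_le, -le_sup_iff]
    refine ⟨⟨?_, ?_⟩, ?_, ?_⟩ <;> linarith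

theorem coord_mem {a : Bool} {lo hi z : ℝ} (h1 : lo ≤ z) (h2 : z ≤ hi) :
    0 ≤ coord a lo hi z ∧ coord a lo hi z ≤ hi - lo := by
  cases a <;> simp only [coord, Bool.false_eq_true, if_false, if_true] <;>
    constructor <;> linarith

theorem exists_coord_eq {ι : Type*} {f : ι → ℝ} {a : Bool} {lo hi : ℝ} (h1 : ∃ i, f i = lo)
    (h2 : ∃ i, f i = hi) : ∃ i, coord a lo hi (f i) = hi - lo := by
  obtain ⟨i, hi'⟩ := h1
  obtain ⟨j, hj'⟩ := h2
  cases a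
  · exact ⟨i, by simp [coord, hi']⟩
  · exact ⟨j, by simp [coord, hj']⟩

/-- Every solution that beats walking is matched by the best one at some corner. -/
theorem exists_cornerFeasible {n : ℕ} {S : Fin n → ℝ × ℝ} {v : ℝ} (hv : 1 < v) {s : State}
    (h : Hull S v n s) {g t t' : ℝ × ℝ}
    (hR : 2 * radius v S g t t' < max (s.rreg 9 - s.rreg 8) (s.rreg 11 - s.rreg 10)) :
    ∃ a b, CornerFeasible v (fun i => coord a (s.rreg 8) (s.rreg 9) ((S i).1 + (S i).2))
      (fun i => coord b (s.rreg 10) (s.rreg 11) ((S i).1 - (S i).2))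
      (s.rreg 9 - s.rreg 8) (s.rreg 11 - s.rreg 10) (radius v S g t t') := by
  have hv0 : 0 < v := by linarith
  obtain ⟨e, he⟩ := exists_turnpike_to_facility hv0 g t t'
  have hrad := travelTime_le_radius v S g t t'
  obtain ⟨i₁, h₁⟩ := h.exists_left
  obtain ⟨i₂, h₂⟩ := h.exists_right
  obtain ⟨i₃, h₃⟩ := h.exists_bottom
  obtain ⟨i₄, h₄⟩ := h.exists_top
  set R := radius v S g t t'
  have hcover : TwoSquareCover v (fun i => (S i).1 + (S i).2 - s.rreg 8)
      (fun i => (S i).1 - (S i).2 - s.rreg 10) (s.rreg 9 - s.rreg 8) (s.rreg 11 - s.rreg 10) R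
      (R - l2Dist e g / v) (g.1 + g.2 - s.rreg 8) (g.1 - g.2 - s.rreg 10) (e.1 + e.2 - s.rreg 8)
      (e.1 - e.2 - s.rreg 10) := by
    refine ⟨⟨i₂, by rw [h₂]⟩, ⟨i₄, by rw [h₄]⟩, ⟨i₁, by rw [h₁, sub_self]⟩,
      ⟨i₃, by rw [h₃, sub_self]⟩, fun i => ?_, fun i => ?_, ?_, ?_, fun i => ?_⟩
    · have := h.left i i.isLt
      have := h.right i i.isLt
      constructor <;> linarith
    · have := h.bottom i i.isLt
      have := h.top i i.isLt
      constructor <;> linarith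
    · linarith [div_nonneg (l2Dist_nonneg e g) hv0.le]
    · have hsq : l2Dist e g ^ 2 = (e.1 - g.1) ^ 2 + (e.2 - g.2) ^ 2 :=
        Real.sq_sqrt (by positivity)
      rw [sub_sub_cancel, mul_div_cancel₀ _ hv0.ne', hsq]
      apply le_of_eq
      ring
    · rcases min_le_iff.1 ((he (S i)).trans (hrad i)) with hi | hi
      · left
        simpa only [l1Dist_eq_max, max_le_iff, sub_sub_sub_cancel_right] using hi
      · right
        have hi' := le_sub_iff_add_le.2 hi
        simpa only [l1Dist_eq_max, max_le_iff, sub_sub_sub_cancel_right] using hi'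
  obtain ⟨a, b, hab⟩ := hcover.exists_corner hv hR
  refine ⟨a, b, ?_⟩
  simpa only [coord_eq_flip] using hab

/-- The running time of the program is at most this constant times
`(n + 1) * (Nat.log 2 n + 2)`. -/
def programCost : ℕ :=
  hullInit.worst + (((Test.ile (.reg 1 + .const 1) (.reg 0)).cost + 1 + hullBody.worst) +
    (walkCmd.worst + (cornerCost true true + (cornerCost true false + (cornerCost false true +
      cornerCost false false)))))

theorem program_spec {n M : ℕ} (hM : n + n + (n + n) ≤ M) (hn : 0 < n) (S : Fin n → ℝ × ℝ) {v : ℝ}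
    (hv : 1 < v) : Runs M program (input S v) (programCost * ((n + 1) * (Nat.log 2 n + 2)))
      fun s => IsOptimal v S (s.point 0) (s.point 1) (s.point 2) := by
  have hseq : Runs M program (input S v)
      (hullInit.worst + (((Test.ile (.reg 1 + .const 1) (.reg 0)).cost + 1 + hullBody.worst) *
        (n + 1) + (walkCmd.worst +
        (cornerCost true true * ((n + 1) * (Nat.log 2 n + 2)) +
        (cornerCost true false * ((n + 1) * (Nat.log 2 n + 2)) +
        (cornerCost false true * ((n + 1) * (Nat.log 2 n + 2)) +
          cornerCost false false * ((n + 1) * (Nat.log 2 n + 2))))))))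
      fun s => IsOptimal v S (s.point 0) (s.point 1) (s.point 2) := by
    refine (wp.runs (hullInit_spec hM hn S v)).seq ?_
    rintro s ⟨h1, hs⟩
    refine (hull_spec hM h1 hs).seq fun s hs => ?_
    refine (wp.runs (walk_spec hs)).seq ?_
    rintro s₀ ⟨h₀, hg, h7⟩
    have step : ∀ (a b : Bool) (s : State), Kept n s₀ s → Good v S s →
        Runs M (cornerCmd a b) s (cornerCost a b * ((n + 1) * (Nat.log 2 n + 2)))
          (Searched S v (fun i => coord a (s₀.rreg 8) (s₀.rreg 9) ((S i).1 + (S i).2))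
            (fun i => coord b (s₀.rreg 10) (s₀.rreg 11) ((S i).1 - (S i).2))
            (s₀.rreg 9 - s₀.rreg 8) (s₀.rreg 11 - s₀.rreg 10) s) := fun a b s hk hg =>
      corner_spec hM hn hv ((h₀.setting a b).congr hk)
        (fun i => coord_mem (h₀.left i i.isLt) (h₀.right i i.isLt))
        (fun i => coord_mem (h₀.bottom i i.isLt) (h₀.top i i.isLt))
        (exists_coord_eq (f := fun i => (S i).1 + (S i).2) h₀.exists_left h₀.exists_right)
        (exists_coord_eq (f := fun i => (S i).1 - (S i).2) h₀.exists_bottom h₀.exists_top) hg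
    refine (step true true s₀ ⟨rfl, fun _ _ => rfl, fun _ _ => rfl⟩ hg).seq fun s₁ c₁ => ?_
    have k₁ := c₁.kept
    refine (step true false s₁ k₁ c₁.good).seq fun s₂ c₂ => ?_
    have k₂ := k₁.trans c₂.kept
    refine (step false true s₂ k₂ c₂.good).seq fun s₃ c₃ => ?_
    have k₃ := k₂.trans c₃.kept
    refine (step false false s₃ k₃ c₃.good).mono le_rfl fun s₄ c₄ => ?_
    have l₁ := c₁.le
    have l₂ := c₂.le
    have l₃ := c₃.le
    have l₄ := c₄.le
    intro g t t'
    refine (radius_le hn c₄.good).trans ?_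
    rcases lt_or_ge (2 * radius v S g t t')
      (max (s₀.rreg 9 - s₀.rreg 8) (s₀.rreg 11 - s₀.rreg 10)) with hR | hR
    · obtain ⟨a, b, hab⟩ := exists_cornerFeasible hv h₀ hR
      cases a <;> cases b
      · exact c₄.corner _ hab
      · linarith [c₃.corner _ hab]
      · linarith [c₂.corner _ hab]
      · linarith [c₁.corner _ hab]
    · linarith
  refine hseq.mono ?_ fun _ h => h
  have e1 : ∀ c, c ≤ c * ((n + 1) * (Nat.log 2 n + 2)) := fun c =>
    Nat.le_mul_of_pos_right c (by positivity)
  have e2 : ∀ c, c * (n + 1) ≤ c * ((n + 1) * (Nat.log 2 n + 2)) := fun c =>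
    Nat.mul_le_mul_left c (Nat.le_mul_of_pos_right _ (by omega))
  unfold programCost
  simp only [add_mul _ _ ((n + 1) * (Nat.log 2 n + 2))]
  have := e1 hullInit.worst
  have := e2 ((Test.ile (.reg 1 + .const 1) (.reg 0)).cost + 1 + hullBody.worst)
  have := e1 walkCmd.worst
  simp only [add_mul _ _ ((n + 1) * (Nat.log 2 n + 2))] at *
  omega

theorem isBigO_mul_natLog (C : ℕ) :
    (fun n : ℕ => ((C * ((n + 1) * (Nat.log 2 n + 2)) : ℕ) : ℝ)) =O[Filter.atTop]
      fun n : ℕ => (n : ℝ) * Real.log (n : ℝ) := by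
  refine Asymptotics.IsBigO.of_bound (C * (6 / Real.log 2)) ?_
  filter_upwards [Filter.eventually_ge_atTop 2] with n hn
  have hn' : (2 : ℝ) ≤ n := by exact_mod_cast hn
  have h2 : 0 < Real.log 2 := Real.log_pos (by norm_num)
  have hlog : Real.log 2 ≤ Real.log n := Real.log_le_log (by norm_num) hn'
  have h1 : 1 ≤ Real.log n / Real.log 2 := (one_le_div h2).2 hlog
  have h3 : (Nat.log 2 n : ℝ) ≤ Real.log n / Real.log 2 := Real.natLog_le_logb n 2
  have h4 : ((n : ℝ) + 1) * (Nat.log 2 n + 2) ≤ (2 * n) * (3 * (Real.log n / Real.log 2)) :=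
    mul_le_mul (by linarith) (by linarith) (by positivity) (by positivity)
  rw [Real.norm_of_nonneg (by positivity), Real.norm_of_nonneg (by positivity)]
  push_cast
  calc (C : ℝ) * ((n + 1) * (Nat.log 2 n + 2))
      ≤ C * ((2 * n) * (3 * (Real.log n / Real.log 2))) := by gcongr
    _ = C * (6 / Real.log 2) * (n * Real.log n) := by ring

end RealRAM

/-- The variable-length 1-center 1-turnpike problem is solved by one real RAM program, in
`O(n log n)` steps and with `O(n)` memory cells; the program leaves the facility and the two
endpoints of the turnpike in its first six real registers. -/
theorem mainTheorem2 :
    ∃ (prog : RealRAM.Cmd) (time space : ℕ → ℕ),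
      ((fun n : ℕ => (time n : ℝ)) =O[Filter.atTop] fun n : ℕ => (n : ℝ) * Real.log (n : ℝ)) ∧
      ((fun n : ℕ => (space n : ℝ)) =O[Filter.atTop] fun n : ℕ => (n : ℝ)) ∧
      ∀ (n : ℕ) (S : Fin n → ℝ × ℝ) (v : ℝ), 0 < n → 1 < v →
        ∃ (k : ℕ) (s : RealRAM.State),
          k ≤ time n ∧
          RealRAM.Exec (space n) prog (RealRAM.input S v) k s ∧
          Turnpike.IsOptimal v S (s.point 0) (s.point 1) (s.point 2) := by
  refine ⟨RealRAM.program,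
    fun n => RealRAM.programCost * ((n + 1) * (Nat.log 2 n + 2)), fun n => n + n + (n + n),
    RealRAM.isBigO_mul_natLog _, ?_, fun n S v hn hv => RealRAM.program_spec le_rfl hn S hv⟩
  refine Asymptotics.IsBigO.of_bound 4 (Filter.Eventually.of_forall fun n => ?_)
  rw [Real.norm_of_nonneg (by positivity), Real.norm_of_nonneg (by positivity)]
  push_cast
  linarith
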